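/- Let $\mathbb F$ be a field over which every quadratic and every cubic polynomial has a root. An *algebra* is an $\mathbb F$-vector space $\mathbb A$ with a bilinear product (not necessarily associative, commutative or unital). For a two-dimensional algebra $\mathbb A$, a *nontrivial* left (right, two-sided) ideal is a one-dimensional subspace $I$ with $vu\in I$ (respectively $uv\in I$, both) for all $u\in I$, $v\in\mathbb A$; $\mathbb A$ is *simple* if it has no nontrivial two-sided ideal. We write $$A=\begin{pmatrix}\alpha_1&\alpha_2&\alpha_3&\alpha_4\\ \beta_1&\beta_2&\beta_3&\beta_4\end{pmatrix}$$ for the algebra with basis $e_1,e_2$ and $e_1e_1=\alpha_1e_1+\beta_1e_2$, $e_1e_2=\alpha_2e_1+\beta_2e_2$, $e_2e_1=\alpha_3e_1+\beta_3e_2$, $e_2e_2=\alpha_4e_1+\beta_4e_2$, and also $(\alpha_1,\alpha_2,\alpha_3,\alpha_4;\beta_1,\beta_2,\beta_3,\beta_4)$ for this matrix. Put $$P_1=(\beta_3-\beta_2)^2\alpha_2+(\beta_3-\beta_2)(\alpha_3-\alpha_2)(\alpha_1-\beta_2)-(\alpha_3-\alpha_2)^2\beta_1,$$ $$P_2=(\beta_3-\beta_2)^2\alpha_4+(\beta_3-\beta_2)(\alpha_3-\alpha_2)(\alpha_3-\beta_4)-(\alpha_3-\alpha_2)^2\beta_3.$$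 **(I)** Let $\mathbb A$ be a two-dimensional algebra with the above structure constants in a basis $e_1,e_2$. Then $\mathbb A$ is simple if and only if one of the following holds: 1. $\beta_2\ne\beta_3$ and $\alpha_2=\alpha_3\ne0$; 2. $\beta_2\ne\beta_3$, $\alpha_2=\alpha_3=0$ and $\alpha_4\ne0$; 3. $\alpha_2\ne\alpha_3$, and $P_1\neq 0$ or $P_2\ne0$; 4. $\beta_2=\beta_3$, $\alpha_2=\alpha_3$ (that is, $\mathbb A$ is commutative), and $\mathbb A$ has no nontrivial left ideal. If $\alpha_2=\alpha_3=\alpha_4=0$ then $\mathbb Fe_2$ is a two-sided ideal. If $\alpha_2\ne\alpha_3$ then $\mathbb F\bigl(e_1+\frac{\beta_3-\beta_2}{\alpha_3-\alpha_2}e_2\bigr)$ is a two-sided ideal if and only if $P_1=P_2=0$. If $\beta_3=\beta_2$ and $\alpha_3=\alpha_2$ then $\mathbb A$ is commutative and its nontrivial left, right and two-sided ideals coincide. **(II)** A two-dimensional algebra with nonzero product has exactly $0$, $1$ or $2$ nontrivial two-sided ideals. **(III)** Consider the following algebras, with parameters ranging over $\mathbb F$. In every characteristic: $A_1(\alpha_1,\alpha_2,\alpha_4,\beta_1)=(\alpha_1,\alpha_2,\alpha_2+1,\alpha_4;\beta_1,-\alpha_1,-\alpha_1+1,-\alpha_2)$,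 $A_2(\alpha_1,\beta_1,\beta_2)=(\alpha_1,0,0,1;\beta_1,\beta_2,1-\alpha_1,0)$, $A_4(\alpha_1,\beta_2)=(\alpha_1,0,0,0;0,\beta_2,1-\alpha_1,0)$, $A_{12}=(0,0,0,0;1,0,0,0)$. In characteristic $\neq2$: $A_3(\beta_1,\beta_2)=(0,1,1,0;\beta_1,\beta_2,1,-1)$, $A_6(\alpha_1,\beta_1)=(\alpha_1,0,0,1;\beta_1,1-\alpha_1,-\alpha_1,0)$, $A_7(\beta_1)=(0,1,1,0;\beta_1,1,0,-1)$, $A_8(\alpha_1)=(\alpha_1,0,0,0;0,1-\alpha_1,-\alpha_1,0)$, $A_{10}=(0,1,1,0;0,0,0,-1)$. In characteristic $\ne2,3$: $A_5(\alpha_1)=(\alpha_1,0,0,0;1,2\alpha_1-1,1-\alpha_1,0)$, $A_9=(\frac13,0,0,0;1,\frac23,-\frac13,0)$, $A_{11}=(0,1,1,0;1,0,0,-1)$. In characteristic $2$: $A_{3,2}(\alpha_1,\beta_2)=(\alpha_1,1,1,0;0,\beta_2,1-\alpha_1,1)$, $A_{5,2}(\alpha_1)=(\alpha_1,0,0,0;1,1,1-\alpha_1,0)$,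 $A_{6,2}(\alpha_1,\beta_1)=(\alpha_1,0,0,1;\beta_1,1-\alpha_1,\alpha_1,0)$, $A_{7,2}(\alpha_1)=(\alpha_1,1,1,0;0,1-\alpha_1,\alpha_1,1)$, $A_{8,2}(\alpha_1)=(\alpha_1,0,0,0;0,1-\alpha_1,\alpha_1,0)$, $A_{9,2}=(1,0,0,0;1,0,1,0)$, $A_{10,2}=(0,1,1,0;0,0,0,1)$, $A_{11,2}=(1,1,1,0;0,1,1,1)$. In characteristic $3$: $A_{5,3}(\alpha_1)=(\alpha_1,0,0,0;1,-1-\alpha_1,1-\alpha_1,0)$, $A_{9,3}=(0,1,1,0;1,0,0,-1)$, $A_{11,3}=(1,0,0,0;1,-1,-1,0)$. The number of nontrivial two-sided ideals of these algebras is as follows. *Characteristic $\ne2,3$.* - $A_1$: $1$ if $\alpha_4=-\alpha_1-2\alpha_2$ and $\beta_1=2\alpha_1+\alpha_2$; otherwise $0$. - $A_2$: $0$ if and only if $\beta_2\neq1-\alpha_1$ or $\beta_1^2+(\alpha_1-1)(2\alpha_1-1)^2\ne0$; $1$ if and only if $\alpha_1\ne\frac12$, $\beta_2=1-\alpha_1$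 and $\beta_1^2+(\alpha_1-1)(2\alpha_1-1)^2=0$; $2$ if and only if $\alpha_1=\beta_2=\frac12$ and $\beta_1=0$. - $A_3$: $1$ if $\beta_2=1$ and $\beta_1=-\frac14$; otherwise $0$. - $A_4$: $2$ if $\alpha_1=1$ and $\beta_2=0$; otherwise $1$. - $A_6,A_7,A_{11}$: $0$. $A_5,A_8,A_9,A_{10},A_{12}$: $1$. *Characteristic $2$.* - $A_1$: $1$ if $\alpha_4=\alpha_1$ and $\beta_1=\alpha_2$; otherwise $0$. - $A_2$: $1$ if $\beta_2=1-\alpha_1$ and $1-\alpha_1+\beta_1^2=0$; otherwise $0$. - $A_{3,2}$: $2$ if $\alpha_1=1$ and $\beta_2=0$; otherwise $0$. - $A_4$: $2$ if $\alpha_1=1$ and $\beta_2=0$; otherwise $1$. - $A_{6,2},A_{7,2},A_{11,2}$: $0$. $A_{5,2},A_{8,2},A_{9,2},A_{10,2},A_{12}$: $1$. *Characteristic $3$.* - $A_1$, $A_2$, $A_4$: as in characteristic $\ne 2,3$. - $A_3$: $1$ if $\beta_2=1$ and $\beta_1=-1$; otherwise $0$. - $A_6,A_7,A_{9,3}$: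 $0$. $A_{5,3},A_8,A_{10},A_{11,3},A_{12}$: $1$. **(IV)** A two-dimensional algebra over $\mathbb F$ is simple if and only if it is isomorphic to a member of the following list: - characteristic $\ne2,3$: $A_1$ with $\alpha_4\neq-\alpha_1-2\alpha_2$ or $\beta_1\ne2\alpha_1+\alpha_2$; $A_2$ with $\beta_2\ne1-\alpha_1$ or $\beta_1^2+(\alpha_1-1)(2\alpha_1-1)^2\ne0$; $A_3$ with $\beta_2\ne1$ or $\beta_1\neq-\frac14$; all $A_6$; all $A_7$; $A_{11}$; - characteristic $2$: $A_1$ with $\alpha_4\ne\alpha_1$ or $\beta_1\ne\alpha_2$; $A_2$ with $\beta_2\neq1-\alpha_1$ or $1-\alpha_1+\beta_1^2\ne0$; $A_{3,2}$ with $\alpha_1\ne1$ or $\beta_2\neq0$; all $A_{6,2}$; all $A_{7,2}$; $A_{11,2}$; - characteristic $3$: $A_1$ with $\alpha_4\neq-\alpha_1-2\alpha_2$ or $\beta_1\ne2\alpha_1+\alpha_2$; $A_2$ with $\beta_2\ne1-\alpha_1$ or $\beta_1^2+(\alpha_1-1)(2\alpha_1-1)^2\ne0$; $A_3$ with $\beta_2\ne1$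 or $\beta_1\neq-1$; all $A_6$; all $A_7$; $A_{9,3}$. In characteristic $2$ two members of the list are isomorphic only if their matrices are equal. In the other characteristics two members are isomorphic if and only if their matrices are equal or they are $A_2(\alpha_1,\beta_1,\beta_2)$ and $A_2(\alpha_1,-\beta_1,\beta_2)$, or $A_6(\alpha_1,\beta_1)$ and $A_6(\alpha_1,-\beta_1)$, for some parameters. -/

import Mathlib

open Polynomial

universe u

/-- Every quadratic and every cubic polynomial over `F` has a root in `F`. -/
def QuadraticCubicClosed (F : Type*) [Field F] : Prop :=
  ∀ p : F[X], p.natDegree = 2 ∨ p.natDegree = 3 → ∃ x : F, p.IsRoot x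

section Algebras

variable (F : Type*) [Field F]
variable (A : Type*) [NonUnitalNonAssocRing A] [Module F A]
variable (B : Type*) [NonUnitalNonAssocRing B] [Module F B]

/-- The nontrivial (that is, one-dimensional) left ideals of a two-dimensional algebra. -/
def nontrivialLeftIdeals : Set (Submodule F A) :=
  {I | Module.finrank F I = 1 ∧ ∀ u ∈ I, ∀ v : A, v * u ∈ I}

/-- The nontrivial (that is, one-dimensional) right ideals of a two-dimensional algebra. -/
def nontrivialRightIdeals : Set (Submodule F A) :=
  {I | Module.finrank F I = 1 ∧ ∀ u ∈ I, ∀ v : A, u * v ∈ I}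

/-- The nontrivial (that is, one-dimensional) two-sided ideals of a two-dimensional algebra. -/
def nontrivialTwoSidedIdeals : Set (Submodule F A) :=
  {I | Module.finrank F I = 1 ∧ ∀ u ∈ I, ∀ v : A, v * u ∈ I ∧ u * v ∈ I}

/-- A two-dimensional algebra is simple if it has no nontrivial two-sided ideal. -/
def IsSimpleTwoDim : Prop := nontrivialTwoSidedIdeals F A = ∅

/-- Isomorphism of (not necessarily associative or unital) algebras over `F`. -/
def AlgIsomorphic : Prop := ∃ f : A ≃ₗ[F] B, ∀ x y : A, f (x * y) = f x * f y

end Algebras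

section Concrete

variable {F : Type u} [Field F]

/-- The algebra with underlying space `F²` and matrix of structure constants
`M = !![α₁, α₂, α₃, α₄; β₁, β₂, β₃, β₄]`, that is, with product `u · v = M (u ⊗ v)`:
`e₁e₁ = α₁e₁ + β₁e₂`, `e₁e₂ = α₂e₁ + β₂e₂`, `e₂e₁ = α₃e₁ + β₃e₂`, `e₂e₂ = α₄e₁ + β₄e₂`. -/
def MSCAlg (_M : Matrix (Fin 2) (Fin 4) F) : Type u := Fin 2 → F

variable (M : Matrix (Fin 2) (Fin 4) F)

instance : AddCommGroup (MSCAlg M) := inferInstanceAs (AddCommGroup (Fin 2 → F))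

instance : Module F (MSCAlg M) := inferInstanceAs (Module F (Fin 2 → F))

/-- The coordinate vector of `u ⊗ v` in the basis `e₁⊗e₁, e₁⊗e₂, e₂⊗e₁, e₂⊗e₂`. -/
def tensorCoords (u v : Fin 2 → F) : Fin 4 → F := ![u 0 * v 0, u 0 * v 1, u 1 * v 0, u 1 * v 1]

instance : Mul (MSCAlg M) := ⟨fun u v => (M.mulVec (tensorCoords u v) : Fin 2 → F)⟩

theorem MSCAlg.mul_apply (x y : MSCAlg M) (i : Fin 2) :
    (x * y) i = M i 0 * (x 0 * y 0) + M i 1 * (x 0 * y 1) + M i 2 * (x 1 * y 0)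
      + M i 3 * (x 1 * y 1) := by
  change (M.mulVec (tensorCoords x y)) i = _
  simp [Matrix.mulVec, dotProduct, Fin.sum_univ_four, tensorCoords]

theorem MSCAlg.add_apply (x y : MSCAlg M) (i : Fin 2) : (x + y) i = x i + y i := rfl

theorem MSCAlg.smul_apply (c : F) (x : MSCAlg M) (i : Fin 2) : (c • x) i = c * x i := rfl

theorem MSCAlg.zero_apply (i : Fin 2) : (0 : MSCAlg M) i = 0 := rfl

instance : NonUnitalNonAssocRing (MSCAlg M) where
  left_distrib x y z := by
    funext i; simp only [MSCAlg.mul_apply, MSCAlg.add_apply]; ring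
  right_distrib x y z := by
    funext i; simp only [MSCAlg.mul_apply, MSCAlg.add_apply]; ring
  zero_mul x := by
    funext i; simp only [MSCAlg.mul_apply, MSCAlg.zero_apply]; ring
  mul_zero x := by
    funext i; simp only [MSCAlg.mul_apply, MSCAlg.zero_apply]; ring

instance : IsScalarTower F (MSCAlg M) (MSCAlg M) where
  smul_assoc c x y := by
    funext i; simp only [smul_eq_mul, MSCAlg.mul_apply, MSCAlg.smul_apply]; ring

instance : SMulCommClass F (MSCAlg M) (MSCAlg M) where
  smul_comm c x y := by
    funext i; simp only [smul_eq_mul, MSCAlg.mul_apply, MSCAlg.smul_apply]; ring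

/-- The number of nontrivial two-sided ideals of the algebra with structure constants `M`. -/
noncomputable def numIdeals : ℕ∞ := (nontrivialTwoSidedIdeals F (MSCAlg M)).encard

end Concrete

/-! The canonical matrices of structure constants. `A1`, `A2`, `A4` and `A12` are used in every
characteristic, `A3`, `A6`, `A7`, `A8` and `A10` in every characteristic other than `2`. The suffix
`c2` (`c3`) marks the forms that are special to characteristic `2` (`3`); `A5`, `A9` and `A11`
without suffix belong to the characteristics other than `2` and `3`. -/
namespace CanonicalForm

variable {F : Type u} [Field F]

def A1 (α₁ α₂ α₄ β₁ : F) : Matrix (Fin 2) (Fin 4) F :=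
  !![α₁, α₂, α₂ + 1, α₄; β₁, -α₁, -α₁ + 1, -α₂]

def A2 (α₁ β₁ β₂ : F) : Matrix (Fin 2) (Fin 4) F := !![α₁, 0, 0, 1; β₁, β₂, 1 - α₁, 0]

def A3 (β₁ β₂ : F) : Matrix (Fin 2) (Fin 4) F := !![0, 1, 1, 0; β₁, β₂, 1, -1]

def A4 (α₁ β₂ : F) : Matrix (Fin 2) (Fin 4) F := !![α₁, 0, 0, 0; 0, β₂, 1 - α₁, 0]

def A5 (α₁ : F) : Matrix (Fin 2) (Fin 4) F := !![α₁, 0, 0, 0; 1, 2 * α₁ - 1, 1 - α₁, 0]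

def A6 (α₁ β₁ : F) : Matrix (Fin 2) (Fin 4) F := !![α₁, 0, 0, 1; β₁, 1 - α₁, -α₁, 0]

def A7 (β₁ : F) : Matrix (Fin 2) (Fin 4) F := !![0, 1, 1, 0; β₁, 1, 0, -1]

def A8 (α₁ : F) : Matrix (Fin 2) (Fin 4) F := !![α₁, 0, 0, 0; 0, 1 - α₁, -α₁, 0]

def A9 : Matrix (Fin 2) (Fin 4) F := !![1 / 3, 0, 0, 0; 1, 2 / 3, -(1 / 3), 0]

def A10 : Matrix (Fin 2) (Fin 4) F := !![0, 1, 1, 0; 0, 0, 0, -1]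

def A11 : Matrix (Fin 2) (Fin 4) F := !![0, 1, 1, 0; 1, 0, 0, -1]

def A12 : Matrix (Fin 2) (Fin 4) F := !![0, 0, 0, 0; 1, 0, 0, 0]

def A3c2 (α₁ β₂ : F) : Matrix (Fin 2) (Fin 4) F := !![α₁, 1, 1, 0; 0, β₂, 1 - α₁, 1]

def A5c2 (α₁ : F) : Matrix (Fin 2) (Fin 4) F := !![α₁, 0, 0, 0; 1, 1, 1 - α₁, 0]

def A6c2 (α₁ β₁ : F) : Matrix (Fin 2) (Fin 4) F := !![α₁, 0, 0, 1; β₁, 1 - α₁, α₁, 0]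

def A7c2 (α₁ : F) : Matrix (Fin 2) (Fin 4) F := !![α₁, 1, 1, 0; 0, 1 - α₁, α₁, 1]

def A8c2 (α₁ : F) : Matrix (Fin 2) (Fin 4) F := !![α₁, 0, 0, 0; 0, 1 - α₁, α₁, 0]

def A9c2 : Matrix (Fin 2) (Fin 4) F := !![1, 0, 0, 0; 1, 0, 1, 0]

def A10c2 : Matrix (Fin 2) (Fin 4) F := !![0, 1, 1, 0; 0, 0, 0, 1]

def A11c2 : Matrix (Fin 2) (Fin 4) F := !![1, 1, 1, 0; 0, 1, 1, 1]

def A5c3 (α₁ : F) : Matrix (Fin 2) (Fin 4) F := !![α₁, 0, 0, 0; 1, -1 - α₁, 1 - α₁, 0]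

def A9c3 : Matrix (Fin 2) (Fin 4) F := !![0, 1, 1, 0; 1, 0, 0, -1]

def A11c3 : Matrix (Fin 2) (Fin 4) F := !![1, 0, 0, 0; 1, -1, -1, 0]

variable (F)

/-- The list of simple algebras in characteristic different from `2` and `3`. -/
def simpleForms : Set (Matrix (Fin 2) (Fin 4) F) :=
  {M | (∃ α₁ α₂ α₄ β₁ : F, (α₄ ≠ -α₁ - 2 * α₂ ∨ β₁ ≠ 2 * α₁ + α₂) ∧ M = A1 α₁ α₂ α₄ β₁) ∨
    (∃ α₁ β₁ β₂ : F, (β₂ ≠ 1 - α₁ ∨ β₁ ^ 2 + (α₁ - 1) * (2 * α₁ - 1) ^ 2 ≠ 0) ∧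
      M = A2 α₁ β₁ β₂) ∨
    (∃ β₁ β₂ : F, (β₂ ≠ 1 ∨ β₁ ≠ -(1 / 4)) ∧ M = A3 β₁ β₂) ∨
    (∃ α₁ β₁ : F, M = A6 α₁ β₁) ∨
    (∃ β₁ : F, M = A7 β₁) ∨
    M = A11}

/-- The list of simple algebras in characteristic `2`. -/
def simpleFormsc2 : Set (Matrix (Fin 2) (Fin 4) F) :=
  {M | (∃ α₁ α₂ α₄ β₁ : F, (α₄ ≠ α₁ ∨ β₁ ≠ α₂) ∧ M = A1 α₁ α₂ α₄ β₁) ∨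
    (∃ α₁ β₁ β₂ : F, (β₂ ≠ 1 - α₁ ∨ 1 - α₁ + β₁ ^ 2 ≠ 0) ∧ M = A2 α₁ β₁ β₂) ∨
    (∃ α₁ β₂ : F, (α₁ ≠ 1 ∨ β₂ ≠ 0) ∧ M = A3c2 α₁ β₂) ∨
    (∃ α₁ β₁ : F, M = A6c2 α₁ β₁) ∨
    (∃ α₁ : F, M = A7c2 α₁) ∨
    M = A11c2}

/-- The list of simple algebras in characteristic `3`. -/
def simpleFormsc3 : Set (Matrix (Fin 2) (Fin 4) F) :=
  {M | (∃ α₁ α₂ α₄ β₁ : F, (α₄ ≠ -α₁ - 2 * α₂ ∨ β₁ ≠ 2 * α₁ + α₂) ∧ M = A1 α₁ α₂ α₄ β₁) ∨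
    (∃ α₁ β₁ β₂ : F, (β₂ ≠ 1 - α₁ ∨ β₁ ^ 2 + (α₁ - 1) * (2 * α₁ - 1) ^ 2 ≠ 0) ∧
      M = A2 α₁ β₁ β₂) ∨
    (∃ β₁ β₂ : F, (β₂ ≠ 1 ∨ β₁ ≠ -1) ∧ M = A3 β₁ β₂) ∨
    (∃ α₁ β₁ : F, M = A6 α₁ β₁) ∨
    (∃ β₁ : F, M = A7 β₁) ∨
    M = A9c3}

variable {F}

/-- The coincidences `A₂(α₁, β₁, β₂) ≃ A₂(α₁, -β₁, β₂)` and `A₆(α₁, β₁) ≃ A₆(α₁, -β₁)`. -/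
def SignRelated (M N : Matrix (Fin 2) (Fin 4) F) : Prop :=
  (∃ α₁ β₁ β₂ : F, M = A2 α₁ β₁ β₂ ∧ N = A2 α₁ (-β₁) β₂) ∨
    (∃ α₁ β₁ : F, M = A6 α₁ β₁ ∧ N = A6 α₁ (-β₁))

end CanonicalForm

open CanonicalForm

/-!
A line `F(x e₁ + y e₂)` is a two-sided ideal if and only if `(x, y)` satisfies four binary quadratic
equations, one for each product with a basis vector (`span_mem_ideals_iff`). The ideals thus form a
subset of the projective line, and `encard_ideals` counts them as the common roots `t` of four
polynomials in the slope, plus one for the point at infinity `Fe₂`. If the algebra is not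
commutative, an ideal contains the commutator `e₁e₂ - e₂e₁`, because a quotient of dimension one is
commutative; this gives the criterion for simplicity and at most one ideal. In general one of the
four equations is nontrivial unless the product is zero, so there are at most two ideals. The
counts for the canonical forms follow by solving the equations.

For the classification, consider the linear forms `p(u) = tr (v ↦ vu)` and `q(u) = tr (v ↦ uv)`,
which are pulled back along isomorphisms (`IsIsoMatrix.rightTrace_eq`,
`IsIsoMatrix.leftTrace_eq`). If they are linearly independent, the basis dual to them is canonical
and gives `A₁`. Otherwise they can be made multiples of the first coordinate, one of them equal to
it unless both vanish, which brings the structure constants to the shape `aligned`, with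
`e₁e₂ = s e₁ + ⋯` and `e₂e₂ = ε e₁ - s e₂`. If `p` and `q` are not both zero, the remaining base
changes are `e₁ ↦ e₁ + c e₂`, `e₂ ↦ d e₂`:

* if `ε ≠ 0`, they achieve `ε = 1` and `s = 0`, and then `d = ±1` is the only freedom left (`A₂`, `A₆`);
* if `ε = 0 ≠ s`, they achieve `s = 1`, and `c` removes `α₁` in characteristic other than `2` (`A₃`,
  `A₇`) and `β₁` in characteristic `2`;
* if `ε = s = 0`, then `Fe₂` is an ideal.

If `p = q = 0`, a root of the cubic form `det (u, u u)` as second basis vector leads to `ε = 0`, and the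
same normalisation followed by a rescaling of `e₁` leaves one simple algebra. The normalisations are
carried out in `exists_isReducedForm`, and their rigidity in `IsReducedForm.eq_or_signRelated`. Both
are uniform in the characteristic, which enters through a condition `Q` on `(α₁, β₁)`. In
characteristic `3` the list of simple algebras is the general one, since there `-(1 / 4) = -1` and
`A₁₁` is the matrix called `A9c3`.
-/

/-! ### Lines in a two-dimensional algebra -/

section Lines

variable {F : Type*} [Field F] {A : Type*} [NonUnitalNonAssocRing A] [Module F A]

/-- `M` is the matrix of structure constants of the product of `A` in the basis `e`. -/
structure HasStructureMatrix (e : Module.Basis (Fin 2) F A) (M : Matrix (Fin 2) (Fin 4) F) :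
    Prop where
  mul_00 : e 0 * e 0 = M 0 0 • e 0 + M 1 0 • e 1
  mul_01 : e 0 * e 1 = M 0 1 • e 0 + M 1 1 • e 1
  mul_10 : e 1 * e 0 = M 0 2 • e 0 + M 1 2 • e 1
  mul_11 : e 1 * e 1 = M 0 3 • e 0 + M 1 3 • e 1

/-- The four quadratic equations expressing that the products `e₁u`, `e₂u`, `ue₁`, `ue₂` are
proportional to `u = x e₁ + y e₂`. -/
structure IsIdealDirection (M : Matrix (Fin 2) (Fin 4) F) (x y : F) : Prop where
  left_0 : M 1 0 * x ^ 2 + (M 1 1 - M 0 0) * x * y - M 0 1 * y ^ 2 = 0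
  left_1 : M 1 2 * x ^ 2 + (M 1 3 - M 0 2) * x * y - M 0 3 * y ^ 2 = 0
  right_0 : M 1 0 * x ^ 2 + (M 1 2 - M 0 0) * x * y - M 0 2 * y ^ 2 = 0
  right_1 : M 1 1 * x ^ 2 + (M 1 3 - M 0 1) * x * y - M 0 3 * y ^ 2 = 0

/-- The slopes `t` for which `F(e₁ + t e₂)` is a two-sided ideal. -/
def idealSlopes (M : Matrix (Fin 2) (Fin 4) F) : Set F := {t | IsIdealDirection M 1 t}

theorem basis_combination_eq_iff (e : Module.Basis (Fin 2) F A) {x y z w : F} :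
    x • e 0 + y • e 1 = z • e 0 + w • e 1 ↔ x = z ∧ y = w := by
  constructor
  · intro h
    have h0 := congrArg (fun v => e.repr v 0) h
    have h1 := congrArg (fun v => e.repr v 1) h
    simp at h0 h1
    exact ⟨h0, h1⟩
  · rintro ⟨rfl, rfl⟩; rfl

theorem exists_basis_combination (e : Module.Basis (Fin 2) F A) (v : A) :
    ∃ x y : F, v = x • e 0 + y • e 1 :=
  ⟨e.repr v 0, e.repr v 1, by rw [← Fin.sum_univ_two (fun i => e.repr v i • e i), e.sum_repr]⟩

theorem mem_span_combination_iff (e : Module.Basis (Fin 2) F A) {x y z w : F}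
    (h : x ≠ 0 ∨ y ≠ 0) :
    z • e 0 + w • e 1 ∈ Submodule.span F {x • e 0 + y • e 1} ↔ x * w = y * z := by
  rw [Submodule.mem_span_singleton]
  simp only [smul_add, smul_smul, basis_combination_eq_iff]
  constructor
  · rintro ⟨r, rfl, rfl⟩; ring
  · intro hd
    rcases h with h | h
    · exact ⟨z / x, by field_simp, by field_simp; linear_combination -hd⟩
    · exact ⟨w / y, by field_simp; linear_combination hd, by field_simp⟩

/-- In a two-dimensional algebra, being an ideal is a system of four quadratic equations in the
homogeneous coordinates of a line. -/
theorem span_mem_ideals_iff [IsScalarTower F A A] [SMulCommClass F A A]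
    {e : Module.Basis (Fin 2) F A} {M : Matrix (Fin 2) (Fin 4) F} (hM : HasStructureMatrix e M)
    {x y : F} (h : x ≠ 0 ∨ y ≠ 0) :
    Submodule.span F {x • e 0 + y • e 1} ∈ nontrivialTwoSidedIdeals F A ↔
      IsIdealDirection M x y := by
  set u := x • e 0 + y • e 1 with hu
  have hu0 : u ≠ 0 := by
    intro h0
    have h1 : x • e 0 + y • e 1 = (0 : F) • e 0 + (0 : F) • e 1 := by
      rw [← hu, h0]; simp
    rw [basis_combination_eq_iff] at h1
    rcases h with h | h
    · exact h h1.1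
    · exact h h1.2
  have mulL : ∀ z w : F, (z • e 0 + w • e 1) * u =
      (z * (x * M 0 0 + y * M 0 1) + w * (x * M 0 2 + y * M 0 3)) • e 0 +
      (z * (x * M 1 0 + y * M 1 1) + w * (x * M 1 2 + y * M 1 3)) • e 1 := by
    intro z w
    simp only [hu, add_mul, mul_add, smul_mul_assoc, mul_smul_comm, hM.mul_00, hM.mul_01,
      hM.mul_10, hM.mul_11]
    module
  have mulR : ∀ z w : F, u * (z • e 0 + w • e 1) =
      (z * (x * M 0 0 + y * M 0 2) + w * (x * M 0 1 + y * M 0 3)) • e 0 +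
      (z * (x * M 1 0 + y * M 1 2) + w * (x * M 1 1 + y * M 1 3)) • e 1 := by
    intro z w
    simp only [hu, add_mul, mul_add, smul_mul_assoc, mul_smul_comm, hM.mul_00, hM.mul_01,
      hM.mul_10, hM.mul_11]
    module
  have key : Submodule.span F {u} ∈ nontrivialTwoSidedIdeals F A ↔
      ∀ z w : F, (z • e 0 + w • e 1) * u ∈ Submodule.span F {u} ∧
        u * (z • e 0 + w • e 1) ∈ Submodule.span F {u} := by
    constructor
    · exact fun H z w => H.2 u (Submodule.mem_span_singleton_self u) _
    · intro H
      refine ⟨finrank_span_singleton hu0, ?_⟩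
      intro v hv w
      obtain ⟨r, rfl⟩ := Submodule.mem_span_singleton.1 hv
      obtain ⟨z, w, rfl⟩ := exists_basis_combination e w
      rw [mul_smul_comm, smul_mul_assoc]
      exact ⟨Submodule.smul_mem _ _ (H z w).1, Submodule.smul_mem _ _ (H z w).2⟩
  rw [key]
  simp only [mulL, mulR]
  simp only [hu, mem_span_combination_iff e h]
  constructor
  · intro H
    obtain ⟨h1, h2⟩ := H 1 0
    obtain ⟨h3, h4⟩ := H 0 1
    exact ⟨by linear_combination h1, by linear_combination h3, by linear_combination h2,
      by linear_combination h4⟩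
  · rintro ⟨h1, h2, h3, h4⟩ z w
    exact ⟨by linear_combination z * h1 + w * h2, by linear_combination z * h3 + w * h4⟩

/-- A one-dimensional subspace is either `Fe₂` or of the form `F(e₁ + t e₂)`. -/
theorem eq_span_of_finrank_eq_one (e : Module.Basis (Fin 2) F A) {I : Submodule F A}
    (hI : Module.finrank F I = 1) :
    I = Submodule.span F {(0 : F) • e 0 + (1 : F) • e 1} ∨
      ∃ t : F, I = Submodule.span F {(1 : F) • e 0 + t • e 1} := by
  obtain ⟨v, hv, hspan⟩ := finrank_eq_one_iff'.1 hI
  obtain ⟨x, y, hxy⟩ := exists_basis_combination e (v : A)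
  have hIv : I = Submodule.span F {x • e 0 + y • e 1} := by
    rw [← hxy]
    apply le_antisymm
    · intro w hw
      obtain ⟨c, hc⟩ := hspan ⟨w, hw⟩
      exact Submodule.mem_span_singleton.2 ⟨c, congrArg Subtype.val hc⟩
    · rw [Submodule.span_singleton_le_iff_mem]; exact v.2
  have hne : x ≠ 0 ∨ y ≠ 0 := by
    by_contra! h
    apply hv
    apply Subtype.ext
    rw [hxy, h.1, h.2]; simp
  by_cases hx : x = 0
  · left
    have hy : y ≠ 0 := by simpa [hx] using hne
    rw [hIv, hx, zero_smul, zero_add, zero_add, one_smul,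
      Submodule.span_singleton_smul_eq (IsUnit.mk0 y hy)]
  · right
    refine ⟨y / x, ?_⟩
    rw [hIv, ← Submodule.span_singleton_smul_eq (IsUnit.mk0 x hx)
      ((1 : F) • e 0 + (y / x) • e 1), smul_add, smul_smul, smul_smul, mul_div_cancel₀ _ hx,
      mul_one]

open Classical in
/-- The nontrivial two-sided ideals correspond to the points of the projective line, split into an
affine line and the point at infinity `Fe₂`, that satisfy the four quadratic equations. -/
theorem encard_ideals [IsScalarTower F A A] [SMulCommClass F A A]
    {e : Module.Basis (Fin 2) F A} {M : Matrix (Fin 2) (Fin 4) F} (hM : HasStructureMatrix e M) :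
    (nontrivialTwoSidedIdeals F A).encard =
      (idealSlopes M).encard + if M 0 1 = 0 ∧ M 0 2 = 0 ∧ M 0 3 = 0 then 1 else 0 := by
  have hinf : Submodule.span F {(0 : F) • e 0 + (1 : F) • e 1} ∈ nontrivialTwoSidedIdeals F A ↔
      M 0 1 = 0 ∧ M 0 2 = 0 ∧ M 0 3 = 0 := by
    rw [span_mem_ideals_iff hM (Or.inr one_ne_zero)]
    constructor
    · rintro ⟨h1, h2, h3, h4⟩
      exact ⟨by linear_combination -h1, by linear_combination -h3, by linear_combination -h2⟩
    · rintro ⟨h1, h2, h3⟩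
      constructor <;> simp [h1, h2, h3]
  have hinj : Function.Injective
      (fun t : F => Submodule.span F {(1 : F) • e 0 + t • e 1}) := by
    intro t s h
    have : (1 : F) • e 0 + t • e 1 ∈ Submodule.span F {(1 : F) • e 0 + s • e 1} :=
      h.le (Submodule.mem_span_singleton_self _)
    rw [mem_span_combination_iff e (Or.inl one_ne_zero)] at this
    linear_combination this
  have hne : ∀ t : F, Submodule.span F {(0 : F) • e 0 + (1 : F) • e 1} ≠
      Submodule.span F {(1 : F) • e 0 + t • e 1} := by
    intro t h
    have : (0 : F) • e 0 + (1 : F) • e 1 ∈ Submodule.span F {(1 : F) • e 0 + t • e 1} :=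
      h ▸ Submodule.mem_span_singleton_self _
    rw [mem_span_combination_iff e (Or.inl one_ne_zero)] at this
    simp at this
  have hset : nontrivialTwoSidedIdeals F A =
      (fun t : F => Submodule.span F {(1 : F) • e 0 + t • e 1}) '' idealSlopes M ∪
      (if M 0 1 = 0 ∧ M 0 2 = 0 ∧ M 0 3 = 0 then
        {Submodule.span F {(0 : F) • e 0 + (1 : F) • e 1}} else ∅) := by
    ext I
    constructor
    · intro hI
      rcases eq_span_of_finrank_eq_one e hI.1 with rfl | ⟨t, rfl⟩
      · right
        rw [if_pos (hinf.1 hI)]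
        rfl
      · left
        exact ⟨t, (span_mem_ideals_iff hM (Or.inl one_ne_zero)).1 hI, rfl⟩
    · rintro (⟨t, ht, rfl⟩ | h)
      · exact (span_mem_ideals_iff hM (Or.inl one_ne_zero)).2 ht
      · split_ifs at h with hc
        · rw [Set.mem_singleton_iff.1 h]
          exact hinf.2 hc
        · exact h.elim
  rw [hset, Set.encard_union_eq, hinj.encard_image]
  · split_ifs <;> simp
  · rw [Set.disjoint_left]
    rintro _ ⟨t, -, rfl⟩ h
    split_ifs at h
    · exact hne t h.symm
    · exact h

end Lines

/-! ### Isomorphisms in coordinates -/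

section Isomorphisms

variable {F : Type*} [Field F]

theorem AlgIsomorphic.symm {A B : Type*} [NonUnitalNonAssocRing A] [Module F A]
    [NonUnitalNonAssocRing B] [Module F B] (h : AlgIsomorphic F A B) : AlgIsomorphic F B A := by
  obtain ⟨f, hf⟩ := h
  refine ⟨f.symm, fun x y => ?_⟩
  apply f.injective
  simp [hf]

theorem AlgIsomorphic.trans {A B C : Type*} [NonUnitalNonAssocRing A] [Module F A]
    [NonUnitalNonAssocRing B] [Module F B] [NonUnitalNonAssocRing C] [Module F C]
    (h : AlgIsomorphic F A B) (h' : AlgIsomorphic F B C) : AlgIsomorphic F A C := by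
  obtain ⟨f, hf⟩ := h
  obtain ⟨g, hg⟩ := h'
  exact ⟨f.trans g, fun x y => by simp [hf, hg]⟩

theorem AlgIsomorphic.refl (A : Type*) [NonUnitalNonAssocRing A] [Module F A] :
    AlgIsomorphic F A A := ⟨LinearEquiv.refl F A, fun _ _ => rfl⟩

theorem IsSimpleTwoDim.of_algIsomorphic {A B : Type*} [NonUnitalNonAssocRing A] [Module F A]
    [NonUnitalNonAssocRing B] [Module F B] (h : AlgIsomorphic F A B) (hB : IsSimpleTwoDim F B) :
    IsSimpleTwoDim F A := by
  obtain ⟨f, hf⟩ := h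
  rw [IsSimpleTwoDim, Set.eq_empty_iff_forall_notMem] at hB ⊢
  rintro I ⟨h1, h2⟩
  refine hB (I.map (f : A →ₗ[F] B)) ⟨?_, ?_⟩
  · rw [LinearEquiv.finrank_map_eq, h1]
  · rintro _ ⟨u, hu, rfl⟩ v
    obtain ⟨w, rfl⟩ := f.surjective v
    exact ⟨⟨w * u, (h2 u hu w).1, hf _ _⟩, ⟨u * w, (h2 u hu w).2, hf _ _⟩⟩

theorem isSimpleTwoDim_congr {A B : Type*} [NonUnitalNonAssocRing A] [Module F A]
    [NonUnitalNonAssocRing B] [Module F B] (h : AlgIsomorphic F A B) :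
    IsSimpleTwoDim F A ↔ IsSimpleTwoDim F B :=
  ⟨IsSimpleTwoDim.of_algIsomorphic h.symm, IsSimpleTwoDim.of_algIsomorphic h⟩

theorem isSimpleTwoDim_iff_encard {A : Type*} [NonUnitalNonAssocRing A] [Module F A] :
    IsSimpleTwoDim F A ↔ (nontrivialTwoSidedIdeals F A).encard = 0 := by
  rw [Set.encard_eq_zero, IsSimpleTwoDim]

/-- The standard basis of `MSCAlg M`. -/
noncomputable def stdBasis (M : Matrix (Fin 2) (Fin 4) F) : Module.Basis (Fin 2) F (MSCAlg M) :=
  Module.Basis.ofEquivFun (LinearEquiv.refl F (Fin 2 → F))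

theorem stdBasis_apply (M : Matrix (Fin 2) (Fin 4) F) (i j : Fin 2) :
    stdBasis M i j = if i = j then 1 else 0 := by
  have : stdBasis M i = (Pi.single i 1 : Fin 2 → F) := by
    unfold stdBasis
    exact Module.Basis.coe_ofEquivFun _ |> fun h => congrFun h i
  rw [this, Pi.single_apply]
  simp [eq_comm]

theorem hasStructureMatrix_stdBasis (M : Matrix (Fin 2) (Fin 4) F) :
    HasStructureMatrix (stdBasis M) M := by
  constructor <;> funext i <;> fin_cases i <;>
    simp [MSCAlg.mul_apply, MSCAlg.add_apply, MSCAlg.smul_apply, stdBasis_apply]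

theorem HasStructureMatrix.algIsomorphic {A : Type*} [NonUnitalNonAssocRing A] [Module F A]
    [IsScalarTower F A A] [SMulCommClass F A A] {e : Module.Basis (Fin 2) F A}
    {M : Matrix (Fin 2) (Fin 4) F} (hM : HasStructureMatrix e M) :
    AlgIsomorphic F A (MSCAlg M) := by
  have hN := hasStructureMatrix_stdBasis M
  have hf : ∀ i, e.equiv (stdBasis M) (Equiv.refl _) (e i) = stdBasis M i := fun i =>
    e.equiv_apply i (stdBasis M) (Equiv.refl _)
  refine ⟨e.equiv (stdBasis M) (Equiv.refl _), fun v w => ?_⟩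
  obtain ⟨x, y, rfl⟩ := exists_basis_combination e v
  obtain ⟨z, w, rfl⟩ := exists_basis_combination e w
  simp only [add_mul, mul_add, smul_mul_assoc, mul_smul_comm, hM.mul_00, hM.mul_01,
    hM.mul_10, hM.mul_11, map_add, map_smul, hf, hN.mul_00, hN.mul_01, hN.mul_10, hN.mul_11]

theorem exists_hasStructureMatrix {A : Type*} [NonUnitalNonAssocRing A] [Module F A]
    (h : Module.finrank F A = 2) :
    ∃ (e : Module.Basis (Fin 2) F A) (M : Matrix (Fin 2) (Fin 4) F), HasStructureMatrix e M := by
  have : Module.Finite F A := Module.finite_of_finrank_pos (by omega)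
  let e := Module.finBasisOfFinrankEq F A h
  obtain ⟨a, a', h0⟩ := exists_basis_combination e (e 0 * e 0)
  obtain ⟨b, b', h1⟩ := exists_basis_combination e (e 0 * e 1)
  obtain ⟨c, c', h2⟩ := exists_basis_combination e (e 1 * e 0)
  obtain ⟨d, d', h3⟩ := exists_basis_combination e (e 1 * e 1)
  exact ⟨e, !![a, b, c, d; a', b', c', d'], by simpa using h0, by simpa using h1,
    by simpa using h2, by simpa using h3⟩

/-- `P` is the matrix of an isomorphism from `MSCAlg M` to `MSCAlg N`: its columns are the images
of `e₁` and `e₂`. -/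
structure IsIsoMatrix (M N : Matrix (Fin 2) (Fin 4) F) (P : Matrix (Fin 2) (Fin 2) F) :
    Prop where
  det_ne : P 0 0 * P 1 1 - P 0 1 * P 1 0 ≠ 0
  map_00 : ∀ i, P i 0 * M 0 0 + P i 1 * M 1 0 = N i 0 * (P 0 0 * P 0 0) +
    N i 1 * (P 0 0 * P 1 0) + N i 2 * (P 1 0 * P 0 0) + N i 3 * (P 1 0 * P 1 0)
  map_01 : ∀ i, P i 0 * M 0 1 + P i 1 * M 1 1 = N i 0 * (P 0 0 * P 0 1) +
    N i 1 * (P 0 0 * P 1 1) + N i 2 * (P 1 0 * P 0 1) + N i 3 * (P 1 0 * P 1 1)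
  map_10 : ∀ i, P i 0 * M 0 2 + P i 1 * M 1 2 = N i 0 * (P 0 1 * P 0 0) +
    N i 1 * (P 0 1 * P 1 0) + N i 2 * (P 1 1 * P 0 0) + N i 3 * (P 1 1 * P 1 0)
  map_11 : ∀ i, P i 0 * M 0 3 + P i 1 * M 1 3 = N i 0 * (P 0 1 * P 0 1) +
    N i 1 * (P 0 1 * P 1 1) + N i 2 * (P 1 1 * P 0 1) + N i 3 * (P 1 1 * P 1 1)

theorem IsIsoMatrix.algIsomorphic {M N : Matrix (Fin 2) (Fin 4) F} {P : Matrix (Fin 2) (Fin 2) F}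
    (h : IsIsoMatrix M N P) : AlgIsomorphic F (MSCAlg M) (MSCAlg N) := by
  obtain ⟨δ, hδ⟩ : ∃ δ, δ * (P 0 0 * P 1 1 - P 0 1 * P 1 0) = 1 :=
    ⟨_, inv_mul_cancel₀ h.det_ne⟩
  let f : MSCAlg M ≃ₗ[F] MSCAlg N :=
    { toFun := fun x i => P i 0 * x 0 + P i 1 * x 1
      map_add' := fun x y => by
        funext i
        change _ = (P i 0 * x 0 + P i 1 * x 1) + (P i 0 * y 0 + P i 1 * y 1)
        simp only [MSCAlg.add_apply]
        ring
      map_smul' := fun c x => by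
        funext i
        change _ = c * (P i 0 * x 0 + P i 1 * x 1)
        simp only [MSCAlg.smul_apply]
        ring
      invFun := fun x => (![δ * (P 1 1 * x 0 - P 0 1 * x 1), δ * (P 0 0 * x 1 - P 1 0 * x 0)] :
        Fin 2 → F)
      left_inv := fun x => by
        funext i
        fin_cases i
        · change δ * (_ - _) = x 0
          linear_combination x 0 * hδ
        · change δ * (_ - _) = x 1
          linear_combination x 1 * hδ
      right_inv := fun x => by
        funext i
        fin_cases i
        · change P 0 0 * (δ * _) + P 0 1 * (δ * _) = x 0
          linear_combination x 0 * hδ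
        · change P 1 0 * (δ * _) + P 1 1 * (δ * _) = x 1
          linear_combination x 1 * hδ }
  have hf : ∀ x i, f x i = P i 0 * x 0 + P i 1 * x 1 := fun _ _ => rfl
  refine ⟨f, fun x y => ?_⟩
  funext i
  rw [hf]
  simp only [MSCAlg.mul_apply, hf]
  linear_combination x 0 * y 0 * h.map_00 i + x 0 * y 1 * h.map_01 i + x 1 * y 0 * h.map_10 i +
    x 1 * y 1 * h.map_11 i

theorem AlgIsomorphic.exists_isIsoMatrix {M N : Matrix (Fin 2) (Fin 4) F}
    (h : AlgIsomorphic F (MSCAlg M) (MSCAlg N)) :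
    ∃ P : Matrix (Fin 2) (Fin 2) F, IsIsoMatrix M N P := by
  obtain ⟨f, hf⟩ := h
  let e := stdBasis M
  have hM := hasStructureMatrix_stdBasis M
  refine ⟨Matrix.of fun i j => f (e j) i, ?_, ?_, ?_, ?_, ?_⟩
  · intro hd
    simp only [Matrix.of_apply] at hd
    obtain ⟨x, hx, h0, h1⟩ : ∃ x : Fin 2 → F, x ≠ 0 ∧
        f (e 0) 0 * x 0 + f (e 1) 0 * x 1 = 0 ∧ f (e 0) 1 * x 0 + f (e 1) 1 * x 1 = 0 := by
      have hdet : (!![f (e 0) 0, f (e 1) 0; f (e 0) 1, f (e 1) 1] : Matrix _ _ F).det = 0 := by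
        rw [Matrix.det_fin_two_of]; exact hd
      obtain ⟨x, hx, h⟩ := Matrix.exists_mulVec_eq_zero_iff.2 hdet
      refine ⟨x, hx, ?_, ?_⟩
      · simpa [Matrix.mulVec, dotProduct, Fin.sum_univ_two] using congrFun h 0
      · simpa [Matrix.mulVec, dotProduct, Fin.sum_univ_two] using congrFun h 1
    have hz : f (x 0 • e 0 + x 1 • e 1) = 0 := by
      rw [map_add, map_smul, map_smul]
      funext i
      fin_cases i
      · simp only [MSCAlg.add_apply, MSCAlg.smul_apply, MSCAlg.zero_apply, Fin.zero_eta]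
        linear_combination h0
      · simp only [MSCAlg.add_apply, MSCAlg.smul_apply, MSCAlg.zero_apply, Fin.mk_one]
        linear_combination h1
    have hz' : x 0 • e 0 + x 1 • e 1 = (0 : F) • e 0 + (0 : F) • e 1 := by
      rw [f.map_eq_zero_iff.1 hz]; simp
    rw [basis_combination_eq_iff] at hz'
    apply hx
    funext i
    fin_cases i
    · exact hz'.1
    · exact hz'.2
  all_goals
    intro i
    simp only [Matrix.of_apply]
  · have h := congrFun (hf (e 0) (e 0)) i
    rw [hM.mul_00, map_add, map_smul, map_smul] at h
    simp only [MSCAlg.mul_apply, MSCAlg.add_apply, MSCAlg.smul_apply] at h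
    linear_combination h
  · have h := congrFun (hf (e 0) (e 1)) i
    rw [hM.mul_01, map_add, map_smul, map_smul] at h
    simp only [MSCAlg.mul_apply, MSCAlg.add_apply, MSCAlg.smul_apply] at h
    linear_combination h
  · have h := congrFun (hf (e 1) (e 0)) i
    rw [hM.mul_10, map_add, map_smul, map_smul] at h
    simp only [MSCAlg.mul_apply, MSCAlg.add_apply, MSCAlg.smul_apply] at h
    linear_combination h
  · have h := congrFun (hf (e 1) (e 1)) i
    rw [hM.mul_11, map_add, map_smul, map_smul] at h
    simp only [MSCAlg.mul_apply, MSCAlg.add_apply, MSCAlg.smul_apply] at h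
    linear_combination h

end Isomorphisms

/-! ### The simplicity criterion -/

section Criterion

variable {F : Type*} [Field F] {A : Type*} [NonUnitalNonAssocRing A] [Module F A]
  {e : Module.Basis (Fin 2) F A} {M : Matrix (Fin 2) (Fin 4) F}

theorem isSimpleTwoDim_iff [IsScalarTower F A A] [SMulCommClass F A A]
    (hM : HasStructureMatrix e M) :
    IsSimpleTwoDim F A ↔
      (∀ t, ¬ IsIdealDirection M 1 t) ∧ ¬ (M 0 1 = 0 ∧ M 0 2 = 0 ∧ M 0 3 = 0) := by
  classical
  rw [isSimpleTwoDim_iff_encard, encard_ideals hM, add_eq_zero, Set.encard_eq_zero,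
    Set.eq_empty_iff_forall_notMem]
  simp [idealSlopes]

/-- An ideal line contains the commutator `e₁e₂ - e₂e₁`, which determines its slope. -/
theorem IsIdealDirection.slope_eq {t : F} (h : IsIdealDirection M 1 t) :
    M 1 2 - M 1 1 = (M 0 2 - M 0 1) * t := by
  linear_combination h.left_1 - h.right_1

/-- If `α₂ ≠ α₃`, then only the line of the commutator can be an ideal, and two of the four equations
follow from the others. -/
theorem isIdealDirection_commutator_iff (h : M 0 1 ≠ M 0 2) :
    IsIdealDirection M 1 ((M 1 2 - M 1 1) / (M 0 2 - M 0 1)) ↔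
      (M 1 2 - M 1 1) ^ 2 * M 0 1 + (M 1 2 - M 1 1) * (M 0 2 - M 0 1) * (M 0 0 - M 1 1)
        - (M 0 2 - M 0 1) ^ 2 * M 1 0 = 0 ∧
      (M 1 2 - M 1 1) ^ 2 * M 0 3 + (M 1 2 - M 1 1) * (M 0 2 - M 0 1) * (M 0 2 - M 1 3)
        - (M 0 2 - M 0 1) ^ 2 * M 1 2 = 0 := by
  have hd : M 0 2 - M 0 1 ≠ 0 := sub_ne_zero.2 h.symm
  obtain ⟨r, hr⟩ : ∃ r, r = (M 1 2 - M 1 1) / (M 0 2 - M 0 1) := ⟨_, rfl⟩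
  have hr' : M 1 2 - M 1 1 = (M 0 2 - M 0 1) * r := by rw [hr]; field_simp
  rw [← hr, hr']
  constructor
  · rintro ⟨h1, h2, -, -⟩
    exact ⟨by linear_combination -(M 0 2 - M 0 1) ^ 2 * h1,
      by linear_combination -(M 0 2 - M 0 1) ^ 2 * h2⟩
  · rintro ⟨h1, h2⟩
    have h1' : M 1 0 + (M 1 1 - M 0 0) * r - M 0 1 * r ^ 2 = 0 := by
      apply mul_left_cancel₀ (pow_ne_zero 2 hd)
      linear_combination -h1
    have h2' : M 1 2 + (M 1 3 - M 0 2) * r - M 0 3 * r ^ 2 = 0 := by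
      apply mul_left_cancel₀ (pow_ne_zero 2 hd)
      linear_combination -h2
    exact ⟨by linear_combination h1', by linear_combination h2',
      by linear_combination h1' + r * hr', by linear_combination h2' - hr'⟩

theorem ideals_eq_of_comm (hc : ∀ x y : A, x * y = y * x) :
    nontrivialLeftIdeals F A = nontrivialTwoSidedIdeals F A ∧
      nontrivialRightIdeals F A = nontrivialTwoSidedIdeals F A := by
  constructor
  · ext I
    exact ⟨fun h => ⟨h.1, fun u hu v => ⟨h.2 u hu v, hc v u ▸ h.2 u hu v⟩⟩,
      fun h => ⟨h.1, fun u hu v => (h.2 u hu v).1⟩⟩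
  · ext I
    exact ⟨fun h => ⟨h.1, fun u hu v => ⟨hc u v ▸ h.2 u hu v, h.2 u hu v⟩⟩,
      fun h => ⟨h.1, fun u hu v => (h.2 u hu v).2⟩⟩

theorem mul_comm_of_structureMatrix [IsScalarTower F A A] [SMulCommClass F A A]
    (hM : HasStructureMatrix e M) (h0 : M 0 1 = M 0 2) (h1 : M 1 1 = M 1 2) (v w : A) : v * w = w * v := by
  obtain ⟨x, y, rfl⟩ := exists_basis_combination e v
  obtain ⟨z, w, rfl⟩ := exists_basis_combination e w
  simp only [add_mul, mul_add, smul_mul_assoc, mul_smul_comm, hM.mul_00, hM.mul_01,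
    hM.mul_10, hM.mul_11, h0, h1]
  module

theorem isSimpleTwoDim_criterion [IsScalarTower F A A] [SMulCommClass F A A]
    (hM : HasStructureMatrix e M) :
    IsSimpleTwoDim F A ↔
      (M 1 1 ≠ M 1 2 ∧ M 0 1 = M 0 2 ∧ M 0 2 ≠ 0) ∨
      (M 1 1 ≠ M 1 2 ∧ M 0 1 = M 0 2 ∧ M 0 2 = 0 ∧ M 0 3 ≠ 0) ∨
      (M 0 1 ≠ M 0 2 ∧
        ((M 1 2 - M 1 1) ^ 2 * M 0 1 + (M 1 2 - M 1 1) * (M 0 2 - M 0 1) * (M 0 0 - M 1 1)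
          - (M 0 2 - M 0 1) ^ 2 * M 1 0 ≠ 0 ∨
        (M 1 2 - M 1 1) ^ 2 * M 0 3 + (M 1 2 - M 1 1) * (M 0 2 - M 0 1) * (M 0 2 - M 1 3)
          - (M 0 2 - M 0 1) ^ 2 * M 1 2 ≠ 0)) ∨
      (M 1 1 = M 1 2 ∧ M 0 1 = M 0 2 ∧ nontrivialLeftIdeals F A = ∅) := by
  by_cases h0 : M 0 1 = M 0 2
  · by_cases h1 : M 1 1 = M 1 2
    · rw [(ideals_eq_of_comm (mul_comm_of_structureMatrix hM h0 h1)).1]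
      simp [h0, h1, IsSimpleTwoDim]
    · have : ∀ t, ¬ IsIdealDirection M 1 t := fun t ht => h1 (by
        linear_combination -ht.slope_eq + t * h0)
      rw [isSimpleTwoDim_iff hM]
      by_cases h2 : M 0 2 = 0 <;> simp [this, h0, Ne, h1, h2]
  · rw [isSimpleTwoDim_iff hM]
    have h2 : ¬ (M 0 1 = 0 ∧ M 0 2 = 0 ∧ M 0 3 = 0) := fun h => h0 (h.1.trans h.2.1.symm)
    have h3 : (∀ t, ¬ IsIdealDirection M 1 t) ↔
        ¬ IsIdealDirection M 1 ((M 1 2 - M 1 1) / (M 0 2 - M 0 1)) := by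
      refine ⟨fun h => h _, fun h t ht => h ?_⟩
      rwa [ht.slope_eq, mul_div_cancel_left₀ _ (sub_ne_zero.2 (Ne.symm h0))]
    rw [h3, isIdealDirection_commutator_iff h0]
    simp only [h0, h2, Ne, not_and_or, not_false_eq_true, false_and, and_false,
      true_and, and_true, false_or, or_false]

open Classical in
/-- A nonzero polynomial of degree at most two has at most two roots, at most one of them if it has
degree at most one. -/
theorem encard_roots_le {a b c : F} (h : a ≠ 0 ∨ b ≠ 0 ∨ c ≠ 0) :
    {t : F | a + b * t - c * t ^ 2 = 0}.encard ≤ if c = 0 then 1 else 2 := by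
  split_ifs with hc
  · rw [Set.encard_le_one_iff]
    intro s t hs ht
    simp only [Set.mem_ofPred_eq, hc, zero_mul, sub_zero] at hs ht
    have hb : b ≠ 0 := by
      rintro rfl
      simp_all
    apply mul_left_cancel₀ hb
    linear_combination hs - ht
  · by_cases hr : ∃ r : F, a + b * r - c * r ^ 2 = 0
    · obtain ⟨r, hr⟩ := hr
      -- The other root comes from Vieta's formula for the sum of the roots.
      have : {t : F | a + b * t - c * t ^ 2 = 0} ⊆ {r, b / c - r} := by
        intro t ht
        have ht' : a + b * t - c * t ^ 2 = 0 := ht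
        have : (t - r) * (t - (b / c - r)) = 0 := by
          field_simp
          linear_combination hr - ht'
        rcases mul_eq_zero.1 this with h | h
        · left; linear_combination h
        · right; exact sub_eq_zero.1 h
      exact (Set.encard_le_encard this).trans (Set.encard_insert_le _ _ |>.trans (by
        rw [Set.encard_singleton]; norm_num))
    · have : {t : F | a + b * t - c * t ^ 2 = 0} = ∅ := by
        rw [Set.eq_empty_iff_forall_notMem]
        exact fun t ht => hr ⟨t, ht⟩
      rw [this]; simp

/-- If the product is nonzero, then one of the four quadratic equations is nontrivial. -/
theorem encard_ideals_le_two [IsScalarTower F A A] [SMulCommClass F A A]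
    (hM : HasStructureMatrix e M) (hne : ∃ x y : A, x * y ≠ 0) :
    (nontrivialTwoSidedIdeals F A).encard ≤ 2 := by
  classical
  rw [encard_ideals hM]
  -- If `Fe₂` is an ideal, the quadratic terms vanish, so that at most one slope is left.
  have key : ∀ {a b c : F}, (a ≠ 0 ∨ b ≠ 0 ∨ c ≠ 0) →
      (M 0 1 = 0 ∧ M 0 2 = 0 ∧ M 0 3 = 0 → c = 0) →
      idealSlopes M ⊆ {t : F | a + b * t - c * t ^ 2 = 0} →
      (idealSlopes M).encard + (if M 0 1 = 0 ∧ M 0 2 = 0 ∧ M 0 3 = 0 then 1 else 0) ≤ 2 := by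
    intro a b c h hc hs
    have h1 := (Set.encard_le_encard hs).trans (encard_roots_le h)
    split_ifs with h2
    · rw [if_pos (hc h2)] at h1
      calc _ ≤ (1 : ℕ∞) + 1 := by gcongr
        _ = 2 := by norm_num
    · rw [add_zero]
      refine h1.trans ?_
      split_ifs <;> norm_num
  by_contra hcon
  have z1 : ¬ (M 1 0 ≠ 0 ∨ M 1 1 - M 0 0 ≠ 0 ∨ M 0 1 ≠ 0) := fun h =>
    hcon (key h (fun h => h.1) fun t ht => by
      have := ht.left_0
      simpa using this)
  have z2 : ¬ (M 1 2 ≠ 0 ∨ M 1 3 - M 0 2 ≠ 0 ∨ M 0 3 ≠ 0) := fun h =>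
    hcon (key h (fun h => h.2.2) fun t ht => by
      have := ht.left_1
      simpa using this)
  have z3 : ¬ (M 1 0 ≠ 0 ∨ M 1 2 - M 0 0 ≠ 0 ∨ M 0 2 ≠ 0) := fun h =>
    hcon (key h (fun h => h.2.1) fun t ht => by
      have := ht.right_0
      simpa using this)
  have z4 : ¬ (M 1 1 ≠ 0 ∨ M 1 3 - M 0 1 ≠ 0 ∨ M 0 3 ≠ 0) := fun h =>
    hcon (key h (fun h => h.2.2) fun t ht => by
      have := ht.right_1
      simpa using this)
  simp only [ne_eq, not_or, not_not, sub_eq_zero] at z1 z2 z3 z4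
  obtain ⟨b1, b2, a2⟩ := z1
  obtain ⟨b3, b4, a4⟩ := z2
  obtain ⟨-, b3', a3⟩ := z3
  obtain ⟨b2', -, -⟩ := z4
  obtain ⟨v, w, hvw⟩ := hne
  apply hvw
  obtain ⟨x, y, rfl⟩ := exists_basis_combination e v
  obtain ⟨z, w, rfl⟩ := exists_basis_combination e w
  have a1 : M 0 0 = 0 := by rw [← b2, b2']
  simp [add_mul, mul_add, smul_mul_assoc, mul_smul_comm, hM.mul_00, hM.mul_01,
    hM.mul_10, hM.mul_11, a1, a2, a3, a4, b1, b2', b3, b4]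

theorem ENat.eq_zero_or_one_or_two {n : ℕ∞} (h : n ≤ 2) : n = 0 ∨ n = 1 ∨ n = 2 := by
  lift n to ℕ using ne_top_of_le_ne_top (by decide) h
  have : n ≤ 2 := by exact_mod_cast h
  interval_cases n <;> simp

end Criterion

/-! ### The number of ideals of the canonical forms -/

section Counts

variable {F : Type*} [Field F]

theorem mem_idealSlopes_of (α₁ α₂ α₃ α₄ β₁ β₂ β₃ β₄ t : F) :
    t ∈ idealSlopes !![α₁, α₂, α₃, α₄; β₁, β₂, β₃, β₄] ↔
      β₁ + (β₂ - α₁) * t - α₂ * t ^ 2 = 0 ∧ β₃ + (β₄ - α₃) * t - α₄ * t ^ 2 = 0 ∧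
      β₁ + (β₃ - α₁) * t - α₃ * t ^ 2 = 0 ∧ β₂ + (β₄ - α₂) * t - α₄ * t ^ 2 = 0 := by
  constructor
  · rintro ⟨h1, h2, h3, h4⟩
    simp at h1 h2 h3 h4
    exact ⟨h1, h2, h3, h4⟩
  · rintro ⟨h1, h2, h3, h4⟩
    constructor <;> simpa

theorem numIdeals_eq_zero {M : Matrix (Fin 2) (Fin 4) F}
    (h : ¬ (M 0 1 = 0 ∧ M 0 2 = 0 ∧ M 0 3 = 0)) (hs : ∀ t, t ∉ idealSlopes M) :
    numIdeals M = 0 := by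
  rw [numIdeals, encard_ideals (hasStructureMatrix_stdBasis M), if_neg h,
    Set.eq_empty_of_forall_notMem hs, Set.encard_empty, add_zero]

theorem numIdeals_eq_one {M : Matrix (Fin 2) (Fin 4) F}
    (h : ¬ (M 0 1 = 0 ∧ M 0 2 = 0 ∧ M 0 3 = 0)) (r : F) (hs : ∀ t, t ∈ idealSlopes M ↔ t = r) :
    numIdeals M = 1 := by
  rw [numIdeals, encard_ideals (hasStructureMatrix_stdBasis M), if_neg h,
    show idealSlopes M = {r} from Set.ext hs, Set.encard_singleton, add_zero]

theorem numIdeals_eq_two {M : Matrix (Fin 2) (Fin 4) F}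
    (h : ¬ (M 0 1 = 0 ∧ M 0 2 = 0 ∧ M 0 3 = 0)) {r s : F} (hrs : r ≠ s)
    (hs : ∀ t, t ∈ idealSlopes M ↔ t = r ∨ t = s) :
    numIdeals M = 2 := by
  rw [numIdeals, encard_ideals (hasStructureMatrix_stdBasis M), if_neg h,
    show idealSlopes M = {r, s} from Set.ext hs, Set.encard_pair hrs, add_zero]

theorem numIdeals_eq_one_of_infinity {M : Matrix (Fin 2) (Fin 4) F}
    (h : M 0 1 = 0 ∧ M 0 2 = 0 ∧ M 0 3 = 0) (hs : ∀ t, t ∉ idealSlopes M) :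
    numIdeals M = 1 := by
  rw [numIdeals, encard_ideals (hasStructureMatrix_stdBasis M), if_pos h,
    Set.eq_empty_of_forall_notMem hs, Set.encard_empty, zero_add]

theorem numIdeals_eq_two_of_infinity {M : Matrix (Fin 2) (Fin 4) F}
    (h : M 0 1 = 0 ∧ M 0 2 = 0 ∧ M 0 3 = 0) (r : F) (hs : ∀ t, t ∈ idealSlopes M ↔ t = r) :
    numIdeals M = 2 := by
  rw [numIdeals, encard_ideals (hasStructureMatrix_stdBasis M), if_pos h,
    show idealSlopes M = {r} from Set.ext hs, Set.encard_singleton]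
  norm_num

theorem eq_iff_and_eq_iff {n a b : ℕ∞} (hab : a ≠ b) {p : Prop} (hp : p → n = a)
    (hn : ¬ p → n = b) : (n = b ↔ ¬ p) ∧ (n = a ↔ p) := by
  by_cases h : p
  · simp [h, hp h, hab]
  · simp [h, hn h, hab.symm]

/-- The commutator `-(e₁ + e₂)` forces the slope `1`. -/
theorem numIdeals_A1 (α₁ α₂ α₄ β₁ : F) :
    (numIdeals (A1 α₁ α₂ α₄ β₁) = 0 ↔ α₄ ≠ -α₁ - 2 * α₂ ∨ β₁ ≠ 2 * α₁ + α₂) ∧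
      (numIdeals (A1 α₁ α₂ α₄ β₁) = 1 ↔ α₄ = -α₁ - 2 * α₂ ∧ β₁ = 2 * α₁ + α₂) := by
  have hinf : ¬ (A1 α₁ α₂ α₄ β₁ 0 1 = 0 ∧ A1 α₁ α₂ α₄ β₁ 0 2 = 0 ∧ A1 α₁ α₂ α₄ β₁ 0 3 = 0) := by
    simp +contextual [A1]
  rw [Ne, Ne, ← not_and_or]
  refine eq_iff_and_eq_iff one_ne_zero ?_ ?_
  · rintro ⟨ha, hb⟩
    refine numIdeals_eq_one hinf 1 fun t => ?_
    rw [A1, mem_idealSlopes_of, ha, hb]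
    constructor
    · rintro ⟨-, h2, -, h4⟩
      linear_combination h4 - h2
    · rintro rfl
      refine ⟨?_, ?_, ?_, ?_⟩ <;> ring
  · intro h
    refine numIdeals_eq_zero hinf fun t => ?_
    rw [A1, mem_idealSlopes_of]
    rintro ⟨h1, h2, h3, h4⟩
    obtain rfl : t = 1 := by linear_combination h4 - h2
    exact h ⟨by linear_combination -h2, by linear_combination h1⟩

theorem numIdeals_A2_eq_zero {α₁ β₁ β₂ : F}
    (h : ¬ (β₂ = 1 - α₁ ∧ β₁ ^ 2 + (α₁ - 1) * (2 * α₁ - 1) ^ 2 = 0)) :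
    numIdeals (A2 α₁ β₁ β₂) = 0 := by
  refine numIdeals_eq_zero (by simp [A2]) fun t => ?_
  rw [A2, mem_idealSlopes_of]
  rintro ⟨h1, h2, h3, h4⟩
  refine h ⟨by linear_combination h4 - h2, ?_⟩
  linear_combination (β₁ - (1 - 2 * α₁) * t) * h3 - (1 - 2 * α₁) ^ 2 * h2

theorem numIdeals_A2_eq_one {α₁ β₁ β₂ : F} (hα : 2 * α₁ - 1 ≠ 0) (hβ : β₂ = 1 - α₁)
    (h : β₁ ^ 2 + (α₁ - 1) * (2 * α₁ - 1) ^ 2 = 0) : numIdeals (A2 α₁ β₁ β₂) = 1 := by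
  subst hβ
  obtain ⟨r, hr⟩ : ∃ r, r = β₁ / (2 * α₁ - 1) := ⟨_, rfl⟩
  have hr' : β₁ = (2 * α₁ - 1) * r := by rw [hr]; field_simp
  have hr2 : r ^ 2 = 1 - α₁ := by
    apply mul_left_cancel₀ (pow_ne_zero 2 hα)
    rw [hr'] at h
    linear_combination h
  refine numIdeals_eq_one (by simp [A2]) r fun t => ?_
  rw [A2, mem_idealSlopes_of]
  constructor
  · rintro ⟨h1, -, -, -⟩
    apply mul_left_cancel₀ hα
    linear_combination hr' - h1
  · rintro rfl
    exact ⟨by linear_combination hr', by linear_combination -hr2, by linear_combination hr',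
      by linear_combination -hr2⟩

theorem numIdeals_A2_eq_two {α₁ β₁ β₂ : F} (h2 : (2 : F) ≠ 0) (hsq : ∀ a : F, ∃ x, x ^ 2 = a)
    (hα : α₁ = 1 / 2) (hβ : β₂ = 1 / 2) (h : β₁ = 0) : numIdeals (A2 α₁ β₁ β₂) = 2 := by
  obtain ⟨r, hr⟩ := hsq (1 / 2)
  have h22 : (2 : F) * (1 / 2) = 1 := by field_simp
  have hr0 : r ≠ 0 := by
    rintro rfl
    exact h2 (by linear_combination (-2 : F) * h22 - 4 * hr)
  have hrr : r ≠ -r := fun h => hr0 (by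
    apply mul_left_cancel₀ h2
    linear_combination h)
  refine numIdeals_eq_two (by simp [A2]) hrr fun t => ?_
  rw [A2, mem_idealSlopes_of, ← sq_eq_sq_iff_eq_or_eq_neg, hr, hα, hβ, h]
  constructor
  · rintro ⟨-, -, -, h4⟩
    linear_combination -h4
  · intro ht
    exact ⟨by ring, by linear_combination -ht - h22, by linear_combination - t * h22,
      by linear_combination -ht⟩

theorem numIdeals_A2 (h2 : (2 : F) ≠ 0) (hsq : ∀ a : F, ∃ x, x ^ 2 = a) (α₁ β₁ β₂ : F) :
    (numIdeals (A2 α₁ β₁ β₂) = 0 ↔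
      β₂ ≠ 1 - α₁ ∨ β₁ ^ 2 + (α₁ - 1) * (2 * α₁ - 1) ^ 2 ≠ 0) ∧
    (numIdeals (A2 α₁ β₁ β₂) = 1 ↔
      α₁ ≠ 1 / 2 ∧ β₂ = 1 - α₁ ∧ β₁ ^ 2 + (α₁ - 1) * (2 * α₁ - 1) ^ 2 = 0) ∧
    (numIdeals (A2 α₁ β₁ β₂) = 2 ↔ α₁ = 1 / 2 ∧ β₂ = 1 / 2 ∧ β₁ = 0) := by
  have h22 : (2 : F) * (1 / 2) = 1 := by field_simp
  rw [Ne, Ne, ← not_and_or]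
  by_cases h : β₂ = 1 - α₁ ∧ β₁ ^ 2 + (α₁ - 1) * (2 * α₁ - 1) ^ 2 = 0
  · by_cases hα : α₁ = 1 / 2
    · have hβ₂ : β₂ = 1 / 2 := by rw [h.1, hα]; linear_combination -h22
      have hβ₁ : β₁ = 0 := by
        apply pow_eq_zero_iff two_ne_zero |>.1
        have := h.2
        rw [hα, h22] at this
        linear_combination this
      have hn := numIdeals_A2_eq_two h2 hsq hα hβ₂ hβ₁
      rw [hn]
      exact ⟨by simp [h], by simp [hα], by simp [hα, hβ₂, hβ₁]⟩
    · have hα' : 2 * α₁ - 1 ≠ 0 := fun h0 => hα (by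
        apply mul_left_cancel₀ h2
        linear_combination h0 - h22)
      rw [numIdeals_A2_eq_one hα' h.1 h.2]
      generalize (1 / 2 : F) = c at hα ⊢
      simp [hα, h]
  · have : ¬ (α₁ = 1 / 2 ∧ β₂ = 1 / 2 ∧ β₁ = 0) := by
      rintro ⟨ha, hb, hc⟩
      refine h ⟨by rw [ha, hb]; linear_combination h22, ?_⟩
      rw [ha, hc, h22]
      ring
    rw [numIdeals_A2_eq_zero h]
    simp only [h, this]
    simp

theorem numIdeals_A2_of_two_eq_zero (h2 : (2 : F) = 0) (α₁ β₁ β₂ : F) :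
    (numIdeals (A2 α₁ β₁ β₂) = 0 ↔ β₂ ≠ 1 - α₁ ∨ 1 - α₁ + β₁ ^ 2 ≠ 0) ∧
    (numIdeals (A2 α₁ β₁ β₂) = 1 ↔ β₂ = 1 - α₁ ∧ 1 - α₁ + β₁ ^ 2 = 0) := by
  have hD : β₁ ^ 2 + (α₁ - 1) * (2 * α₁ - 1) ^ 2 = 1 - α₁ + β₁ ^ 2 := by
    rw [h2]
    linear_combination (α₁ - 1) * h2
  rw [← hD, Ne, Ne, ← not_and_or]
  refine eq_iff_and_eq_iff one_ne_zero (fun h => ?_) numIdeals_A2_eq_zero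
  exact numIdeals_A2_eq_one (by simp [h2]) h.1 h.2

theorem numIdeals_A3 (h2 : (2 : F) ≠ 0) (β₁ β₂ : F) :
    (numIdeals (A3 β₁ β₂) = 0 ↔ β₂ ≠ 1 ∨ β₁ ≠ -(1 / 4)) ∧
      (numIdeals (A3 β₁ β₂) = 1 ↔ β₂ = 1 ∧ β₁ = -(1 / 4)) := by
  have h22 : (2 : F) * (1 / 2) = 1 := by field_simp
  have h4 : (1 / 4 : F) = (1 / 2) ^ 2 := by norm_num
  rw [h4, Ne, Ne, ← not_and_or]
  refine eq_iff_and_eq_iff one_ne_zero ?_ ?_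
  · rintro ⟨rfl, rfl⟩
    refine numIdeals_eq_one (by simp [A3]) (1 / 2) fun t => ?_
    rw [A3, mem_idealSlopes_of]
    constructor
    · rintro ⟨-, h, -, -⟩
      apply mul_left_cancel₀ h2
      linear_combination -h - h22
    · rintro rfl
      exact ⟨by linear_combination -(1 / 2 : F) * h22, by linear_combination -h22,
        by linear_combination -(1 / 2 : F) * h22, by linear_combination -h22⟩
  · intro h
    refine numIdeals_eq_zero (by simp [A3]) fun t => ?_
    rw [A3, mem_idealSlopes_of]
    rintro ⟨h1, h3, -, h5⟩
    obtain rfl : t = 1 / 2 := by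
      apply mul_left_cancel₀ h2
      linear_combination -h3 - h22
    obtain rfl : β₂ = 1 := by linear_combination h5 - h3
    exact h ⟨rfl, by linear_combination h1 + (1 / 2 : F) * h22⟩

theorem numIdeals_A4 (α₁ β₂ : F) :
    (numIdeals (A4 α₁ β₂) = 1 ↔ α₁ ≠ 1 ∨ β₂ ≠ 0) ∧
      (numIdeals (A4 α₁ β₂) = 2 ↔ α₁ = 1 ∧ β₂ = 0) := by
  rw [Ne, Ne, ← not_and_or]
  refine eq_iff_and_eq_iff (by norm_num) ?_ ?_
  · rintro ⟨rfl, rfl⟩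
    refine numIdeals_eq_two_of_infinity (by simp [A4]) 0 fun t => ?_
    rw [A4, mem_idealSlopes_of]
    constructor
    · rintro ⟨h, -, -, -⟩
      linear_combination -h
    · rintro rfl
      simp
  · intro h
    refine numIdeals_eq_one_of_infinity (by simp [A4]) fun t => ?_
    rw [A4, mem_idealSlopes_of]
    rintro ⟨-, h2, -, h4⟩
    exact h ⟨by linear_combination -h2, by linear_combination h4⟩

theorem numIdeals_A3c2 (h2 : (2 : F) = 0) (α₁ β₂ : F) :
    (numIdeals (A3c2 α₁ β₂) = 0 ↔ α₁ ≠ 1 ∨ β₂ ≠ 0) ∧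
      (numIdeals (A3c2 α₁ β₂) = 2 ↔ α₁ = 1 ∧ β₂ = 0) := by
  rw [Ne, Ne, ← not_and_or]
  refine eq_iff_and_eq_iff (by norm_num) ?_ ?_
  · rintro ⟨rfl, rfl⟩
    refine numIdeals_eq_two (by simp [A3c2]) zero_ne_one fun t => ?_
    rw [A3c2, mem_idealSlopes_of]
    constructor
    · rintro ⟨h, -, -, -⟩
      have : t * (t - 1) = 0 := by linear_combination -h - t * h2
      rcases mul_eq_zero.1 this with h | h
      · exact Or.inl h
      · exact Or.inr (sub_eq_zero.1 h)
    · rintro (rfl | rfl)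
      · simp
      · exact ⟨by linear_combination -h2, by ring, by linear_combination -h2, by ring⟩
  · intro h
    refine numIdeals_eq_zero (by simp [A3c2]) fun t => ?_
    rw [A3c2, mem_idealSlopes_of]
    rintro ⟨-, h2, -, h4⟩
    exact h ⟨by linear_combination -h2, by linear_combination h4⟩

theorem numIdeals_A5 (α₁ : F) : numIdeals (A5 α₁) = 1 := by
  refine numIdeals_eq_one_of_infinity (by simp [A5]) fun t => ?_
  rw [A5, mem_idealSlopes_of]
  rintro ⟨h1, h2, h3, h4⟩
  exact one_ne_zero (α := F) (by linear_combination 2 * h2 + h4)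

theorem numIdeals_A6 (α₁ β₁ : F) : numIdeals (A6 α₁ β₁) = 0 := by
  refine numIdeals_eq_zero (by simp [A6]) fun t => ?_
  rw [A6, mem_idealSlopes_of]
  rintro ⟨h1, h2, h3, h4⟩
  exact one_ne_zero (α := F) (by linear_combination h4 - h2)

theorem numIdeals_A7 (β₁ : F) : numIdeals (A7 β₁) = 0 := by
  refine numIdeals_eq_zero (by simp [A7]) fun t => ?_
  rw [A7, mem_idealSlopes_of]
  rintro ⟨h1, h2, h3, h4⟩
  exact one_ne_zero (α := F) (by linear_combination h4 - h2)

theorem numIdeals_A8 (α₁ : F) : numIdeals (A8 α₁) = 1 := by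
  refine numIdeals_eq_one_of_infinity (by simp [A8]) fun t => ?_
  rw [A8, mem_idealSlopes_of]
  rintro ⟨h1, h2, h3, h4⟩
  exact one_ne_zero (α := F) (by linear_combination h4 - h2)

theorem numIdeals_A9 (h : (3 : F) ≠ 0) : numIdeals (A9 : Matrix (Fin 2) (Fin 4) F) = 1 := by
  refine numIdeals_eq_one_of_infinity (by simp [A9]) fun t => ?_
  rw [A9, mem_idealSlopes_of]
  rintro ⟨h1, h2, h3, h4⟩
  have h33 : (3 : F) * (1 / 3) = 1 := by field_simp
  exact one_ne_zero (α := F) (by linear_combination h4 - h2 - h33)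

theorem numIdeals_A10 : numIdeals (A10 : Matrix (Fin 2) (Fin 4) F) = 1 := by
  refine numIdeals_eq_one (by simp [A10]) 0 fun t => ?_
  rw [A10, mem_idealSlopes_of]
  constructor
  · rintro ⟨h1, -, -, -⟩
    exact pow_eq_zero_iff two_ne_zero |>.1 (by linear_combination -h1)
  · rintro rfl
    simp

theorem numIdeals_A11 (h : (2 : F) ≠ 0) : numIdeals (A11 : Matrix (Fin 2) (Fin 4) F) = 0 := by
  refine numIdeals_eq_zero (by simp [A11]) fun t => ?_
  rw [A11, mem_idealSlopes_of]
  rintro ⟨h1, h2, h3, h4⟩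
  obtain rfl : t = 0 := by
    apply mul_left_cancel₀ h
    linear_combination -h2
  exact one_ne_zero (α := F) (by linear_combination h1)

theorem numIdeals_A12 : numIdeals (A12 : Matrix (Fin 2) (Fin 4) F) = 1 := by
  refine numIdeals_eq_one_of_infinity (by simp [A12]) fun t => ?_
  rw [A12, mem_idealSlopes_of]
  rintro ⟨h1, h2, h3, h4⟩
  exact one_ne_zero (α := F) (by linear_combination h1)

theorem numIdeals_A5c2 (α₁ : F) : numIdeals (A5c2 α₁) = 1 := by
  refine numIdeals_eq_one_of_infinity (by simp [A5c2]) fun t => ?_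
  rw [A5c2, mem_idealSlopes_of]
  rintro ⟨h1, h2, h3, h4⟩
  exact one_ne_zero (α := F) (by linear_combination h4)

theorem numIdeals_A6c2 (h : (2 : F) = 0) (α₁ β₁ : F) : numIdeals (A6c2 α₁ β₁) = 0 := by
  refine numIdeals_eq_zero (by simp [A6c2]) fun t => ?_
  rw [A6c2, mem_idealSlopes_of]
  rintro ⟨h1, h2, h3, h4⟩
  exact one_ne_zero (α := F) (by linear_combination h4 - h2 + α₁ * h)

theorem numIdeals_A7c2 (h : (2 : F) = 0) (α₁ : F) : numIdeals (A7c2 α₁) = 0 := by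
  refine numIdeals_eq_zero (by simp [A7c2]) fun t => ?_
  rw [A7c2, mem_idealSlopes_of]
  rintro ⟨h1, h2, h3, h4⟩
  exact one_ne_zero (α := F) (by linear_combination h4 - h2 + α₁ * h)

theorem numIdeals_A8c2 (α₁ : F) : numIdeals (A8c2 α₁) = 1 := by
  refine numIdeals_eq_one_of_infinity (by simp [A8c2]) fun t => ?_
  rw [A8c2, mem_idealSlopes_of]
  rintro ⟨h1, h2, h3, h4⟩
  exact one_ne_zero (α := F) (by linear_combination h2 + h4)

theorem numIdeals_A9c2 : numIdeals (A9c2 : Matrix (Fin 2) (Fin 4) F) = 1 := by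
  refine numIdeals_eq_one_of_infinity (by simp [A9c2]) fun t => ?_
  rw [A9c2, mem_idealSlopes_of]
  rintro ⟨h1, h2, h3, h4⟩
  exact one_ne_zero (α := F) (by linear_combination h2)

theorem numIdeals_A10c2 : numIdeals (A10c2 : Matrix (Fin 2) (Fin 4) F) = 1 := by
  refine numIdeals_eq_one (by simp [A10c2]) 0 fun t => ?_
  rw [A10c2, mem_idealSlopes_of]
  constructor
  · rintro ⟨h1, -, -, -⟩
    exact pow_eq_zero_iff two_ne_zero |>.1 (by linear_combination -h1)
  · rintro rfl
    simp

theorem numIdeals_A11c2 : numIdeals (A11c2 : Matrix (Fin 2) (Fin 4) F) = 0 := by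
  refine numIdeals_eq_zero (by simp [A11c2]) fun t => ?_
  rw [A11c2, mem_idealSlopes_of]
  rintro ⟨h1, h2, h3, h4⟩
  exact one_ne_zero (α := F) (by linear_combination h2)

theorem numIdeals_A5c3 (h : (3 : F) = 0) (α₁ : F) : numIdeals (A5c3 α₁) = 1 := by
  refine numIdeals_eq_one_of_infinity (by simp [A5c3]) fun t => ?_
  rw [A5c3, mem_idealSlopes_of]
  rintro ⟨h1, h2, h3, h4⟩
  exact one_ne_zero (α := F) (by linear_combination h4 - h2 + h)

theorem numIdeals_A9c3 (h : (2 : F) ≠ 0) : numIdeals (A9c3 : Matrix (Fin 2) (Fin 4) F) = 0 := by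
  refine numIdeals_eq_zero (by simp [A9c3]) fun t => ?_
  rw [A9c3, mem_idealSlopes_of]
  rintro ⟨h1, h2, h3, h4⟩
  obtain rfl : t = 0 := by
    apply mul_left_cancel₀ h
    linear_combination -h2
  exact one_ne_zero (α := F) (by linear_combination h1)

theorem numIdeals_A11c3 : numIdeals (A11c3 : Matrix (Fin 2) (Fin 4) F) = 1 := by
  refine numIdeals_eq_one_of_infinity (by simp [A11c3]) fun t => ?_
  rw [A11c3, mem_idealSlopes_of]
  rintro ⟨h1, h2, h3, h4⟩
  exact one_ne_zero (α := F) (by linear_combination -h4)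

end Counts

/-! ### The trace forms -/

section Traces

variable {F : Type*} [Field F] {M N : Matrix (Fin 2) (Fin 4) F} {P : Matrix (Fin 2) (Fin 2) F}

/-- The coefficients of the linear form `u ↦ tr (v ↦ v u)` on `MSCAlg M`. -/
def rightTrace (M : Matrix (Fin 2) (Fin 4) F) : Fin 2 → F := ![M 0 0 + M 1 2, M 0 1 + M 1 3]

/-- The coefficients of the linear form `u ↦ tr (v ↦ u v)` on `MSCAlg M`. -/
def leftTrace (M : Matrix (Fin 2) (Fin 4) F) : Fin 2 → F := ![M 0 0 + M 1 1, M 0 2 + M 1 3]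

/-- The trace forms are pulled back along isomorphisms. -/
theorem IsIsoMatrix.rightTrace_eq (h : IsIsoMatrix M N P) (j : Fin 2) :
    rightTrace M j = rightTrace N 0 * P 0 j + rightTrace N 1 * P 1 j := by
  apply mul_left_cancel₀ h.det_ne
  fin_cases j
  · simp only [rightTrace, Fin.zero_eta, Matrix.cons_val]
    linear_combination P 1 1 * h.map_00 0 - P 0 1 * h.map_00 1 + P 0 0 * h.map_10 1 -
      P 1 0 * h.map_10 0
  · simp only [rightTrace, Fin.mk_one, Matrix.cons_val]
    linear_combination P 1 1 * h.map_01 0 - P 0 1 * h.map_01 1 + P 0 0 * h.map_11 1 -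
      P 1 0 * h.map_11 0

theorem IsIsoMatrix.leftTrace_eq (h : IsIsoMatrix M N P) (j : Fin 2) :
    leftTrace M j = leftTrace N 0 * P 0 j + leftTrace N 1 * P 1 j := by
  apply mul_left_cancel₀ h.det_ne
  fin_cases j
  · simp only [leftTrace, Fin.zero_eta, Matrix.cons_val]
    linear_combination P 1 1 * h.map_00 0 - P 0 1 * h.map_00 1 + P 0 0 * h.map_01 1 -
      P 1 0 * h.map_01 0
  · simp only [leftTrace, Fin.mk_one, Matrix.cons_val]
    linear_combination P 1 1 * h.map_10 0 - P 0 1 * h.map_10 1 + P 0 0 * h.map_11 1 -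
      P 1 0 * h.map_11 0

/-- Every invertible matrix is the matrix of an isomorphism onto `MSCAlg M`. -/
theorem exists_isIsoMatrix (M : Matrix (Fin 2) (Fin 4) F)
    (hP : P 0 0 * P 1 1 - P 0 1 * P 1 0 ≠ 0) : ∃ N, IsIsoMatrix N M P := by
  obtain ⟨δ, hδ⟩ : ∃ δ, δ * (P 0 0 * P 1 1 - P 0 1 * P 1 0) = 1 := ⟨_, inv_mul_cancel₀ hP⟩
  have key : ∀ w : Fin 2 → F, ∃ z : Fin 2 → F, ∀ i, P i 0 * z 0 + P i 1 * z 1 = w i := by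
    intro w
    refine ⟨![δ * (P 1 1 * w 0 - P 0 1 * w 1), δ * (P 0 0 * w 1 - P 1 0 * w 0)], fun i => ?_⟩
    fin_cases i
    · simp
      linear_combination w 0 * hδ
    · simp
      linear_combination w 1 * hδ
  obtain ⟨z₁, h₁⟩ := key fun i => M i 0 * (P 0 0 * P 0 0) + M i 1 * (P 0 0 * P 1 0) +
    M i 2 * (P 1 0 * P 0 0) + M i 3 * (P 1 0 * P 1 0)
  obtain ⟨z₂, h₂⟩ := key fun i => M i 0 * (P 0 0 * P 0 1) + M i 1 * (P 0 0 * P 1 1) +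
    M i 2 * (P 1 0 * P 0 1) + M i 3 * (P 1 0 * P 1 1)
  obtain ⟨z₃, h₃⟩ := key fun i => M i 0 * (P 0 1 * P 0 0) + M i 1 * (P 0 1 * P 1 0) +
    M i 2 * (P 1 1 * P 0 0) + M i 3 * (P 1 1 * P 1 0)
  obtain ⟨z₄, h₄⟩ := key fun i => M i 0 * (P 0 1 * P 0 1) + M i 1 * (P 0 1 * P 1 1) +
    M i 2 * (P 1 1 * P 0 1) + M i 3 * (P 1 1 * P 1 1)
  exact ⟨!![z₁ 0, z₂ 0, z₃ 0, z₄ 0; z₁ 1, z₂ 1, z₃ 1, z₄ 1], hP, h₁, h₂, h₃, h₄⟩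

/-- The structure constants of an algebra whose trace forms are multiples of the first coordinate:
the right trace form is `(r, 0)` and the left one is `(l, 0)`. -/
def aligned (α s ε β l r : F) : Matrix (Fin 2) (Fin 4) F := !![α, s, s, ε; β, l - α, r - α, -s]

theorem eq_aligned {l r : F} (hr0 : rightTrace M 0 = r) (hr1 : rightTrace M 1 = 0)
    (hl0 : leftTrace M 0 = l) (hl1 : leftTrace M 1 = 0) :
    M = aligned (M 0 0) (M 0 1) (M 0 3) (M 1 0) l r := by
  simp [rightTrace, leftTrace] at hr0 hr1 hl0 hl1
  ext i j
  fin_cases i <;> fin_cases j <;> simp [aligned]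
  · linear_combination hl1 - hr1
  · linear_combination hl0
  · linear_combination hr0
  · linear_combination hr1

theorem rightTrace_aligned (α s ε β l r : F) : rightTrace (aligned α s ε β l r) = ![r, 0] := by
  simp [rightTrace, aligned]

theorem leftTrace_aligned (α s ε β l r : F) : leftTrace (aligned α s ε β l r) = ![l, 0] := by
  simp [leftTrace, aligned]

theorem eq_A1 (hr0 : rightTrace M 0 = 1) (hr1 : rightTrace M 1 = 0)
    (hl0 : leftTrace M 0 = 0) (hl1 : leftTrace M 1 = 1) :
    M = A1 (M 0 0) (M 0 1) (M 0 3) (M 1 0) := by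
  simp [rightTrace, leftTrace] at hr0 hr1 hl0 hl1
  ext i j
  fin_cases i <;> fin_cases j <;> simp [A1]
  · linear_combination hl1 - hr1
  · linear_combination hl0
  · linear_combination hr0
  · linear_combination hr1

theorem rightTrace_A1 (α₁ α₂ α₄ β₁ : F) : rightTrace (A1 α₁ α₂ α₄ β₁) = ![1, 0] := by
  simp [rightTrace, A1]

theorem leftTrace_A1 (α₁ α₂ α₄ β₁ : F) : leftTrace (A1 α₁ α₂ α₄ β₁) = ![0, 1] := by
  simp [leftTrace, A1]

/-- Lower triangular base changes between algebras with aligned trace forms. -/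
theorem isIsoMatrix_aligned {α s ε β l r α' s' ε' β' l' r' a c d : F} (ha : a ≠ 0) (hd : d ≠ 0)
    (hε : ε * a = d ^ 2 * ε') (hs : s * a = a * d * s' + c * d * ε')
    (hα : α * a = a ^ 2 * α' + 2 * a * c * s' + c ^ 2 * ε')
    (hβ : α * c + β * d = a ^ 2 * β' + a * c * (l' + r' - 2 * α') - c ^ 2 * s')
    (hl : l = a * l') (hr : r = a * r') :
    IsIsoMatrix (aligned α s ε β l r) (aligned α' s' ε' β' l' r') !![a, 0; c, d] := by
  have h1 : s * d - ε * c = d ^ 2 * s' := by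
    apply mul_left_cancel₀ ha
    linear_combination d * hs - c * hε
  have h2 : s * c - α * d = -(a * d * α') - c * d * s' := by
    apply mul_left_cancel₀ ha
    linear_combination c * hs - d * hα
  refine ⟨by simp [ha, hd], fun i => ?_, fun i => ?_, fun i => ?_, fun i => ?_⟩ <;> fin_cases i <;>
    simp [aligned]
  · linear_combination hα
  · linear_combination hβ
  · linear_combination hs
  · linear_combination h2 + d * hl
  · linear_combination hs
  · linear_combination h2 + d * hr
  · linear_combination hε
  · linear_combination -h1

/-- An isomorphism between algebras with nonzero normalised aligned trace forms preserves these forms.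
Hence it maps `e₁` to `e₁ + c e₂` and `e₂` to `d e₂`, which leaves only the equations below. -/
theorem IsIsoMatrix.aligned_eqs {α s ε β l r α' s' ε' β' l' r' : F}
    (h : IsIsoMatrix (aligned α s ε β l r) (aligned α' s' ε' β' l' r') P)
    (hlr : r = 1 ∨ (r = 0 ∧ l = 1)) (hlr' : r' = 1 ∨ (r' = 0 ∧ l' = 1)) :
    l = l' ∧ r = r' ∧ ∃ c d : F, d ≠ 0 ∧ ε = d ^ 2 * ε' ∧ s = d * s' + c * d * ε' ∧
      α = α' + 2 * c * s' + c ^ 2 * ε' ∧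
      α * c + β * d = β' + c * (l' + r' - 2 * α') - c ^ 2 * s' := by
  have r0 := h.rightTrace_eq 0
  have r1 := h.rightTrace_eq 1
  have l0 := h.leftTrace_eq 0
  have l1 := h.leftTrace_eq 1
  simp [rightTrace_aligned, leftTrace_aligned] at r0 r1 l0 l1
  have hb : P 0 1 = 0 := by
    rcases hlr' with h | ⟨-, h⟩
    · simpa [h] using r1
    · simpa [h] using l1
  have hd := h.det_ne
  have ha : P 0 0 = 1 := by
    have h0 : P 0 0 ≠ 0 := fun h0 => hd (by rw [h0, hb]; ring)
    rcases hlr with h1 | ⟨h1, h2⟩ <;> rcases hlr' with h1' | ⟨h1', h2'⟩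
    · simpa [h1, h1', eq_comm] using r0
    · simp [h1, h1'] at r0
    · exact absurd (by simpa [h1, h1'] using r0) h0.symm
    · simpa [h2, h2', eq_comm] using l0
  rw [ha, mul_one] at r0 l0
  refine ⟨l0, r0, P 1 0, P 1 1, fun h0 => hd (by rw [h0, hb]; ring), ?_⟩
  have e1 := h.map_00 0
  have e2 := h.map_00 1
  have e3 := h.map_01 0
  have e4 := h.map_11 0
  simp [aligned, ha, hb] at e1 e2 e3 e4
  exact ⟨by linear_combination e4, by linear_combination e3, by linear_combination e1,
    by linear_combination e2⟩

end Traces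

/-! ### Uniqueness of the reduced form -/

section Uniqueness

variable {F : Type*} [Field F] {Q : F → F → Prop} {M M₀ N : Matrix (Fin 2) (Fin 4) F}

/-- The reduced forms: either the trace forms are the coordinate functions; or they are normalised
multiples of the first coordinate, and the remaining constants are normalised as well, with a
condition `Q` on `(α, β)` in the case `ε = 0` that depends on the characteristic; or they vanish
and the matrix is a fixed one. -/
def IsReducedForm (Q : F → F → Prop) (M₀ M : Matrix (Fin 2) (Fin 4) F) : Prop :=
  (∃ α₁ α₂ α₄ β₁, M = A1 α₁ α₂ α₄ β₁) ∨
  (∃ α s ε β l r, M = aligned α s ε β l r ∧ (r = 1 ∨ (r = 0 ∧ l = 1)) ∧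
    ((s = 0 ∧ ε = 1) ∨ (s = 1 ∧ ε = 0 ∧ Q α β))) ∨
  M = M₀

/-- The determinant of the pair of trace forms is a relative invariant, so its vanishing separates
`A₁` from all other reduced forms. -/
theorem IsIsoMatrix.traceDet_eq {P : Matrix (Fin 2) (Fin 2) F} (h : IsIsoMatrix M N P) :
    rightTrace M 0 * leftTrace M 1 - rightTrace M 1 * leftTrace M 0 =
      (rightTrace N 0 * leftTrace N 1 - rightTrace N 1 * leftTrace N 0) *
        (P 0 0 * P 1 1 - P 0 1 * P 1 0) := by
  rw [h.rightTrace_eq 0, h.rightTrace_eq 1, h.leftTrace_eq 0, h.leftTrace_eq 1]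
  ring

theorem A2_eq_aligned (α₁ β₁ β₂ : F) : A2 α₁ β₁ β₂ = aligned α₁ 0 1 β₁ (β₂ + α₁) 1 := by
  simp [aligned, A2]

theorem A6_eq_aligned (α₁ β₁ : F) : A6 α₁ β₁ = aligned α₁ 0 1 β₁ 1 0 := by
  simp [aligned, A6]

theorem signRelated_of_aligned {α β l r : F} (hlr : r = 1 ∨ (r = 0 ∧ l = 1)) :
    SignRelated (aligned α 0 1 β l r) (aligned α 0 1 (-β) l r) := by
  rcases hlr with rfl | ⟨rfl, rfl⟩
  · exact Or.inl ⟨α, β, l - α, by simp [aligned, A2], by simp [aligned, A2]⟩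
  · exact Or.inr ⟨α, β, by simp [aligned, A6], by simp [aligned, A6]⟩

theorem algIsomorphic_of_signRelated (h : SignRelated M N) :
    AlgIsomorphic F (MSCAlg M) (MSCAlg N) := by
  have key : ∀ α β l r : F, AlgIsomorphic F (MSCAlg (aligned α 0 1 β l r))
      (MSCAlg (aligned α 0 1 (-β) l r)) := fun α β l r =>
    (isIsoMatrix_aligned (a := 1) (c := 0) (d := -1) one_ne_zero (by simp) (by ring) (by ring)
      (by ring) (by ring) (by ring) (by ring)).algIsomorphic
  rcases h with ⟨α, β, β₂, rfl, rfl⟩ | ⟨α, β, rfl, rfl⟩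
  · rw [A2_eq_aligned, A2_eq_aligned]
    exact key _ _ _ _
  · rw [A6_eq_aligned, A6_eq_aligned]
    exact key _ _ _ _

/-- The hypothesis `hQ` says that `Q` leaves no freedom in the remaining base changes
`e₁ ↦ e₁ + c e₂` of the case `s = 1`, `ε = 0`. -/
theorem IsReducedForm.eq_or_signRelated {α₀ β₀ : F} (h₀ : M₀ = aligned α₀ 1 0 β₀ 0 0)
    (hQ : ∀ α β α' β' l r c, Q α β → Q α' β' → α = α' + 2 * c →
      α * c + β = β' + c * (l + r - 2 * α') - c ^ 2 → α = α' ∧ β = β')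
    (hM : IsReducedForm Q M₀ M) (hN : IsReducedForm Q M₀ N)
    (h : AlgIsomorphic F (MSCAlg M) (MSCAlg N)) : M = N ∨ SignRelated M N := by
  obtain ⟨P, hP⟩ := h.exists_isIsoMatrix
  have r0 := hP.rightTrace_eq 0
  have r1 := hP.rightTrace_eq 1
  have l0 := hP.leftTrace_eq 0
  have l1 := hP.leftTrace_eq 1
  have hD := hP.traceDet_eq
  rcases hM with ⟨a, b, c, d, rfl⟩ | ⟨α, s, ε, β, l, r, rfl, hlr, hsε⟩ | rfl <;>
    rcases hN with ⟨a', b', c', d', rfl⟩ | ⟨α', s', ε', β', l', r', rfl, hlr', hsε'⟩ | rfl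
  · simp [rightTrace_A1, leftTrace_A1] at r0 r1 l0 l1
    left
    have e1 := hP.map_00 0
    have e2 := hP.map_00 1
    have e3 := hP.map_01 0
    have e4 := hP.map_11 0
    simp [← r0, ← r1, ← l0, ← l1, A1] at e1 e2 e3 e4
    rw [e1, e2, e3, e4]
  · simp [rightTrace_A1, leftTrace_A1, rightTrace_aligned, leftTrace_aligned] at hD
  · simp [rightTrace_A1, leftTrace_A1, rightTrace_aligned, leftTrace_aligned, h₀] at hD
  · simp [rightTrace_A1, leftTrace_A1, rightTrace_aligned, leftTrace_aligned] at hD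
    exact absurd hD.symm hP.det_ne
  · obtain ⟨rfl, rfl, c, d, hd, hε, hs, hα, hβ⟩ := hP.aligned_eqs hlr hlr'
    rcases hsε with ⟨rfl, rfl⟩ | ⟨rfl, rfl, hq⟩ <;>
      rcases hsε' with ⟨rfl, rfl⟩ | ⟨rfl, rfl, hq'⟩
    · have hc : c = 0 := by simpa [hd] using hs
      subst hc
      have hα' : α = α' := by linear_combination hα
      subst hα'
      have hd2 : d ^ 2 = 1 := by linear_combination -hε
      rcases eq_or_eq_neg_of_sq_eq_sq d 1 (by rw [hd2, one_pow]) with rfl | rfl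
      · left
        have : β = β' := by linear_combination hβ
        rw [this]
      · right
        have : β' = -β := by linear_combination -hβ
        rw [this]
        exact signRelated_of_aligned hlr
    · simp at hε
    · exact absurd (pow_eq_zero_iff two_ne_zero |>.1 (by linear_combination -hε)) hd
    · have hd1 : d = 1 := by linear_combination -hs
      subst hd1
      obtain ⟨rfl, rfl⟩ := hQ α β α' β' l r c hq hq' (by linear_combination hα)
        (by linear_combination hβ)
      exact Or.inl rfl
  · simp [rightTrace_aligned, leftTrace_aligned, h₀] at r0 l0
    simp [r0, l0] at hlr
  · simp [rightTrace_A1, leftTrace_A1, rightTrace_aligned, leftTrace_aligned, h₀] at hD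
    exact absurd hD.symm hP.det_ne
  · obtain ⟨P', hP'⟩ := h.symm.exists_isIsoMatrix
    have r0' := hP'.rightTrace_eq 0
    have l0' := hP'.leftTrace_eq 0
    simp [rightTrace_aligned, leftTrace_aligned, h₀] at r0' l0'
    simp [r0', l0'] at hlr'
  · exact Or.inl rfl

end Uniqueness

/-! ### Existence of the reduced form -/

section Existence

variable {F : Type*} [Field F] {Q : F → F → Prop} {M M₀ N : Matrix (Fin 2) (Fin 4) F}

theorem QuadraticCubicClosed.exists_quadratic_root (hF : QuadraticCubicClosed F) {a : F}
    (b c : F) (ha : a ≠ 0) : ∃ x, a * x ^ 2 + b * x + c = 0 := by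
  obtain ⟨x, hx⟩ := hF _ (Or.inl (natDegree_quadratic (b := b) (c := c) ha))
  exact ⟨x, by simpa [IsRoot] using hx⟩

theorem QuadraticCubicClosed.exists_cubic_root (hF : QuadraticCubicClosed F) {a : F}
    (b c d : F) (ha : a ≠ 0) : ∃ x, a * x ^ 3 + b * x ^ 2 + c * x + d = 0 := by
  obtain ⟨x, hx⟩ := hF _ (Or.inr (natDegree_cubic (b := b) (c := c) (d := d) ha))
  exact ⟨x, by simpa [IsRoot] using hx⟩

theorem QuadraticCubicClosed.exists_sq_eq (hF : QuadraticCubicClosed F) (a : F) :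
    ∃ x, x ^ 2 = a := by
  obtain ⟨x, hx⟩ := hF.exists_quadratic_root 0 (-a) one_ne_zero
  exact ⟨x, by linear_combination hx⟩

/-- If the trace forms are linearly independent, then the dual basis gives the form `A₁`. -/
theorem exists_algIsomorphic_A1
    (hD : rightTrace M 0 * leftTrace M 1 - rightTrace M 1 * leftTrace M 0 ≠ 0) :
    ∃ α₁ α₂ α₄ β₁ : F, AlgIsomorphic F (MSCAlg M) (MSCAlg (A1 α₁ α₂ α₄ β₁)) := by
  obtain ⟨δ, hδ⟩ : ∃ δ, δ * (rightTrace M 0 * leftTrace M 1 - rightTrace M 1 * leftTrace M 0) = 1 :=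
    ⟨_, inv_mul_cancel₀ hD⟩
  have hδ0 : δ ≠ 0 := left_ne_zero_of_mul_eq_one hδ
  obtain ⟨N, hN⟩ := exists_isIsoMatrix M (P := !![δ * leftTrace M 1, -(δ * rightTrace M 1);
    -(δ * leftTrace M 0), δ * rightTrace M 0]) (by
      simp only [Matrix.of_apply, Matrix.cons_val]
      intro h
      apply hδ0
      linear_combination h - δ * hδ)
  have r0 := hN.rightTrace_eq 0
  have r1 := hN.rightTrace_eq 1
  have l0 := hN.leftTrace_eq 0
  have l1 := hN.leftTrace_eq 1
  simp only [Matrix.of_apply, Matrix.cons_val] at r0 r1 l0 l1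
  have := hN.algIsomorphic
  rw [eq_A1 (M := N) (by linear_combination r0 + hδ) (by linear_combination r1)
    (by linear_combination l0) (by linear_combination l1 + hδ)] at this
  exact ⟨_, _, _, _, this.symm⟩

/-- Linearly dependent trace forms can be made multiples of the first coordinate, normalised if
they do not vanish. -/
theorem exists_algIsomorphic_aligned
    (hD : rightTrace M 0 * leftTrace M 1 - rightTrace M 1 * leftTrace M 0 = 0) :
    ∃ α s ε β l r : F, (r = 1 ∨ (r = 0 ∧ l = 1) ∨ (r = 0 ∧ l = 0)) ∧
      AlgIsomorphic F (MSCAlg M) (MSCAlg (aligned α s ε β l r)) := by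
  -- There is a basis whose second vector spans the kernel of a given nonzero form `p`.
  have key : ∀ p : Fin 2 → F, (p 0 ≠ 0 ∨ p 1 ≠ 0) → ∃ (N : Matrix (Fin 2) (Fin 4) F) (x y : F),
      IsIsoMatrix N M !![x, -p 1; y, p 0] ∧ p 0 * x + p 1 * y = 1 := by
    intro p hp
    obtain ⟨x, y, hxy⟩ : ∃ x y, p 0 * x + p 1 * y = 1 := by
      rcases hp with hp | hp
      · exact ⟨(p 0)⁻¹, 0, by simp [hp]⟩
      · exact ⟨0, (p 1)⁻¹, by simp [hp]⟩
    obtain ⟨N, hN⟩ := exists_isIsoMatrix M (P := !![x, -p 1; y, p 0]) (by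
      simp only [Matrix.of_apply, Matrix.cons_val]
      intro h
      exact one_ne_zero (α := F) (by linear_combination h - hxy))
    exact ⟨N, x, y, hN, hxy⟩
  by_cases hr : rightTrace M 0 ≠ 0 ∨ rightTrace M 1 ≠ 0
  · obtain ⟨N, x, y, hN, hxy⟩ := key _ hr
    have r0 := hN.rightTrace_eq 0
    have r1 := hN.rightTrace_eq 1
    have l0 := hN.leftTrace_eq 0
    have l1 := hN.leftTrace_eq 1
    simp only [Matrix.of_apply, Matrix.cons_val] at r0 r1 l0 l1
    have := hN.algIsomorphic
    rw [eq_aligned (M := N) (l := leftTrace N 0) (r := 1) (by linear_combination r0 + hxy)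
      (by linear_combination r1) rfl (by linear_combination l1 + hD)] at this
    exact ⟨_, _, _, _, _, _, Or.inl rfl, this.symm⟩
  · push Not at hr
    by_cases hl : leftTrace M 0 ≠ 0 ∨ leftTrace M 1 ≠ 0
    · obtain ⟨N, x, y, hN, hxy⟩ := key _ hl
      have r0 := hN.rightTrace_eq 0
      have r1 := hN.rightTrace_eq 1
      have l0 := hN.leftTrace_eq 0
      have l1 := hN.leftTrace_eq 1
      simp only [Matrix.of_apply, Matrix.cons_val, hr.1, hr.2, zero_mul, add_zero] at r0 r1 l0 l1
      have := hN.algIsomorphic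
      rw [eq_aligned (M := N) (l := 1) (r := 0) r0 r1 (by linear_combination l0 + hxy)
        (by linear_combination l1)] at this
      exact ⟨_, _, _, _, _, _, Or.inr (Or.inl ⟨rfl, rfl⟩), this.symm⟩
    · push Not at hl
      have hrefl : ∀ N, M = N → AlgIsomorphic F (MSCAlg M) (MSCAlg N) := by
        rintro _ rfl
        exact AlgIsomorphic.refl _
      exact ⟨_, _, _, _, _, _, Or.inr (Or.inr ⟨rfl, rfl⟩),
        hrefl _ (eq_aligned hr.1 hr.2 hl.1 hl.2)⟩

/-- If the kernel of the trace forms is not closed under squaring, then its generator can be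
normalised and the first basis vector can be chosen such that `s = 0`. -/
theorem aligned_normalize_ε (hF : QuadraticCubicClosed F) {ε : F} (hε : ε ≠ 0) (α s β l r : F) :
    ∃ α' β' : F, AlgIsomorphic F (MSCAlg (aligned α s ε β l r)) (MSCAlg (aligned α' 0 1 β' l r)) := by
  obtain ⟨d, hd⟩ := hF.exists_sq_eq ε
  have hd0 : d ≠ 0 := by
    rintro rfl
    exact hε (by rw [← hd]; ring)
  obtain ⟨c, hc⟩ : ∃ c, s = c * d := ⟨s / d, by field_simp⟩
  refine ⟨α - c ^ 2, α * c + β * d - c * (l + r - 2 * (α - c ^ 2)),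
    (isIsoMatrix_aligned (a := 1) (c := c) (d := d) one_ne_zero hd0 ?_ ?_ ?_ ?_ ?_
      ?_).algIsomorphic⟩
  · linear_combination -hd
  · linear_combination hc
  all_goals ring

/-- Rescaling `e₂` gives `s = 1`; the shift `e₁ ↦ e₁ + c e₂` is still free. -/
theorem aligned_normalize_s {s : F} (hs : s ≠ 0) (α β l r c : F) :
    AlgIsomorphic F (MSCAlg (aligned α s 0 β l r)) (MSCAlg (aligned (α - 2 * c) 1 0
      (α * c + β * s - c * (l + r - 2 * (α - 2 * c)) + c ^ 2) l r)) :=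
  (isIsoMatrix_aligned (a := 1) (c := c) (d := s) one_ne_zero hs (by ring) (by ring) (by ring)
    (by ring) (by ring) (by ring)).algIsomorphic

/-- If the trace forms vanish, then the second basis vector can be chosen as a root of the cubic
form `u ↦ det (u, u u)`. -/
theorem aligned_zero_normalize_ε (hF : QuadraticCubicClosed F) (α s ε β : F) :
    ∃ α' s' β' : F, AlgIsomorphic F (MSCAlg (aligned α s ε β 0 0))
      (MSCAlg (aligned α' s' 0 β' 0 0)) := by
  obtain ⟨P, hP, hroot⟩ : ∃ P : Matrix (Fin 2) (Fin 2) F, P 0 0 * P 1 1 - P 0 1 * P 1 0 ≠ 0 ∧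
      β * P 0 1 ^ 3 - 3 * α * P 0 1 ^ 2 * P 1 1 - 3 * s * P 0 1 * P 1 1 ^ 2 - ε * P 1 1 ^ 3 = 0 := by
    by_cases hβ : β = 0
    · exact ⟨!![0, 1; 1, 0], by simp, by simp [hβ]⟩
    · obtain ⟨x, hx⟩ := hF.exists_cubic_root (-(3 * α)) (-(3 * s)) (-ε) hβ
      refine ⟨!![1, x; 0, 1], by simp, ?_⟩
      simp only [Matrix.of_apply, Matrix.cons_val]
      linear_combination hx
  obtain ⟨N, hN⟩ := exists_isIsoMatrix (aligned α s ε β 0 0) hP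
  have r0 := hN.rightTrace_eq 0
  have r1 := hN.rightTrace_eq 1
  have l0 := hN.leftTrace_eq 0
  have l1 := hN.leftTrace_eq 1
  simp only [rightTrace_aligned, leftTrace_aligned, Matrix.cons_val, zero_mul, add_zero]
    at r0 r1 l0 l1
  have hε : N 0 3 = 0 := by
    have h0 := hN.map_11 0
    have h1 := hN.map_11 1
    simp only [aligned, Matrix.of_apply, Matrix.cons_val] at h0 h1
    apply mul_left_cancel₀ hP
    linear_combination P 1 1 * h0 - P 0 1 * h1 - hroot
  have := hN.algIsomorphic
  rw [eq_aligned r0 r1 l0 l1, hε] at this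
  exact ⟨_, _, _, this.symm⟩

/-- If `s = ε = 0`, then `Fe₂` is an ideal. -/
theorem not_isSimpleTwoDim_aligned (α β l r : F) :
    ¬ IsSimpleTwoDim F (MSCAlg (aligned α 0 0 β l r)) := by
  rw [isSimpleTwoDim_iff (hasStructureMatrix_stdBasis _)]
  simp [aligned]

/-- Every simple algebra has a reduced form, provided that the condition `Q` can be achieved by a shift
`e₁ ↦ e₁ + c e₂`, and that `Q` leaves a single simple algebra with vanishing trace forms. -/
theorem exists_isReducedForm (hF : QuadraticCubicClosed F)
    (hQ : ∀ α β l r, ∃ c, Q (α - 2 * c) (α * c + β - c * (l + r - 2 * (α - 2 * c)) + c ^ 2))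
    (h₀ : ∀ α β, Q α β → IsSimpleTwoDim F (MSCAlg (aligned α 1 0 β 0 0)) →
      AlgIsomorphic F (MSCAlg (aligned α 1 0 β 0 0)) (MSCAlg M₀))
    (hM : IsSimpleTwoDim F (MSCAlg M)) :
    ∃ N, IsReducedForm Q M₀ N ∧ AlgIsomorphic F (MSCAlg M) (MSCAlg N) := by
  by_cases hD : rightTrace M 0 * leftTrace M 1 - rightTrace M 1 * leftTrace M 0 = 0
  · obtain ⟨α, s, ε, β, l, r, hlr, hiso⟩ := exists_algIsomorphic_aligned hD
    -- Simplicity forces `s ≠ 0` as soon as `ε = 0`.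
    have step : ∀ α s β l r, AlgIsomorphic F (MSCAlg M) (MSCAlg (aligned α s 0 β l r)) →
        ∃ α' β', Q α' β' ∧ AlgIsomorphic F (MSCAlg M) (MSCAlg (aligned α' 1 0 β' l r)) := by
      intro α s β l r hiso
      have hs : s ≠ 0 := by
        rintro rfl
        exact not_isSimpleTwoDim_aligned _ _ _ _ ((isSimpleTwoDim_congr hiso).1 hM)
      obtain ⟨c, hc⟩ := hQ α (β * s) l r
      exact ⟨_, _, hc, hiso.trans (aligned_normalize_s hs α β l r c)⟩
    rw [← or_assoc] at hlr
    rcases hlr with hlr | ⟨rfl, rfl⟩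
    · by_cases hε : ε = 0
      · subst hε
        obtain ⟨α', β', hq, hiso'⟩ := step _ _ _ _ _ hiso
        exact ⟨_, Or.inr (Or.inl ⟨_, _, _, _, _, _, rfl, hlr, Or.inr ⟨rfl, rfl, hq⟩⟩), hiso'⟩
      · obtain ⟨α', β', h⟩ := aligned_normalize_ε hF hε α s β l r
        exact ⟨_, Or.inr (Or.inl ⟨_, _, _, _, _, _, rfl, hlr, Or.inl ⟨rfl, rfl⟩⟩), hiso.trans h⟩
    · obtain ⟨α', s', β', h⟩ := aligned_zero_normalize_ε hF α s ε β
      obtain ⟨α'', β'', hq, hiso'⟩ := step _ _ _ _ _ (hiso.trans h)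
      exact ⟨M₀, Or.inr (Or.inr rfl), hiso'.trans
        (h₀ _ _ hq ((isSimpleTwoDim_congr hiso').1 hM))⟩
  · obtain ⟨a, b, c, d, h⟩ := exists_algIsomorphic_A1 hD
    exact ⟨_, Or.inl ⟨a, b, c, d, rfl⟩, h⟩

end Existence

/-! ### The lists of simple algebras -/

section Lists

variable {F : Type*} [Field F] {M N : Matrix (Fin 2) (Fin 4) F}

theorem A10_eq_aligned : (A10 : Matrix (Fin 2) (Fin 4) F) = aligned 0 1 0 0 0 0 := by
  simp [A10, aligned]

theorem A11_eq_aligned : (A11 : Matrix (Fin 2) (Fin 4) F) = aligned 0 1 0 1 0 0 := by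
  simp [A11, aligned]

theorem A3_eq_aligned (β₁ β₂ : F) : A3 β₁ β₂ = aligned 0 1 0 β₁ β₂ 1 := by
  simp [A3, aligned]

theorem A7_eq_aligned (β₁ : F) : A7 β₁ = aligned 0 1 0 β₁ 1 0 := by
  simp [A7, aligned]

theorem isSimpleTwoDim_iff_numIdeals : IsSimpleTwoDim F (MSCAlg M) ↔ numIdeals M = 0 :=
  isSimpleTwoDim_iff_encard

theorem not_isSimpleTwoDim_A10 : ¬ IsSimpleTwoDim F (MSCAlg (aligned (0 : F) 1 0 0 0 0)) := by
  rw [← A10_eq_aligned, isSimpleTwoDim_iff_numIdeals, numIdeals_A10]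
  exact one_ne_zero

theorem isReducedForm_of_mem_simpleForms (h : M ∈ simpleForms F) :
    IsReducedForm (fun α _ => α = 0) A11 M := by
  rcases h with ⟨a, b, c, d, -, rfl⟩ | ⟨a, b, c, -, rfl⟩ | ⟨b, c, -, rfl⟩ | ⟨a, b, rfl⟩ | ⟨b, rfl⟩ |
    rfl
  · exact Or.inl ⟨a, b, c, d, rfl⟩
  · exact Or.inr (Or.inl ⟨_, _, _, _, _, _, A2_eq_aligned a b c, Or.inl rfl, Or.inl ⟨rfl, rfl⟩⟩)
  · exact Or.inr (Or.inl ⟨_, _, _, _, _, _, A3_eq_aligned b c, Or.inl rfl,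
      Or.inr ⟨rfl, rfl, rfl⟩⟩)
  · exact Or.inr (Or.inl ⟨_, _, _, _, _, _, A6_eq_aligned a b, Or.inr ⟨rfl, rfl⟩,
      Or.inl ⟨rfl, rfl⟩⟩)
  · exact Or.inr (Or.inl ⟨_, _, _, _, _, _, A7_eq_aligned b, Or.inr ⟨rfl, rfl⟩,
      Or.inr ⟨rfl, rfl, rfl⟩⟩)
  · exact Or.inr (Or.inr rfl)

theorem isSimpleTwoDim_of_mem_simpleForms (h2 : (2 : F) ≠ 0) (h : M ∈ simpleForms F) :
    IsSimpleTwoDim F (MSCAlg M) := by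
  rw [isSimpleTwoDim_iff_numIdeals]
  rcases h with ⟨a, b, c, d, h, rfl⟩ | ⟨a, b, c, h, rfl⟩ | ⟨b, c, h, rfl⟩ | ⟨a, b, rfl⟩ | ⟨b, rfl⟩ |
    rfl
  · exact (numIdeals_A1 a b c d).1.2 h
  · exact numIdeals_A2_eq_zero (not_and_or.2 h)
  · exact (numIdeals_A3 h2 b c).1.2 h
  · exact numIdeals_A6 a b
  · exact numIdeals_A7 b
  · exact numIdeals_A11 h2

theorem mem_simpleForms (hF : QuadraticCubicClosed F) (h2 : (2 : F) ≠ 0)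
    (h : IsReducedForm (fun α _ => α = 0) A11 M) (hM : IsSimpleTwoDim F (MSCAlg M)) :
    M ∈ simpleForms F := by
  rw [isSimpleTwoDim_iff_numIdeals] at hM
  rcases h with ⟨a, b, c, d, rfl⟩ |
    ⟨α, s, ε, β, l, r, rfl, rfl | ⟨rfl, rfl⟩, ⟨rfl, rfl⟩ | ⟨rfl, rfl, rfl⟩⟩ | rfl
  · exact Or.inl ⟨a, b, c, d, (numIdeals_A1 a b c d).1.1 hM, rfl⟩
  · rw [show aligned α 0 1 β l 1 = A2 α β (l - α) by simp [aligned, A2]] at hM ⊢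
    exact Or.inr (Or.inl ⟨_, _, _, (numIdeals_A2 h2 hF.exists_sq_eq _ _ _).1.1 hM, rfl⟩)
  · rw [← A3_eq_aligned] at hM ⊢
    exact Or.inr (Or.inr (Or.inl ⟨_, _, (numIdeals_A3 h2 _ _).1.1 hM, rfl⟩))
  · exact Or.inr (Or.inr (Or.inr (Or.inl ⟨_, _, (A6_eq_aligned _ _).symm⟩)))
  · exact Or.inr (Or.inr (Or.inr (Or.inr (Or.inl ⟨_, (A7_eq_aligned _).symm⟩))))
  · exact Or.inr (Or.inr (Or.inr (Or.inr (Or.inr rfl))))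

theorem isSimpleTwoDim_iff_simpleForms (hF : QuadraticCubicClosed F) (h2 : (2 : F) ≠ 0)
    {A : Type*} [NonUnitalNonAssocRing A] [Module F A] [IsScalarTower F A A]
    [SMulCommClass F A A] (hA : Module.finrank F A = 2) :
    IsSimpleTwoDim F A ↔ ∃ M ∈ simpleForms F, AlgIsomorphic F A (MSCAlg M) := by
  constructor
  · intro hS
    obtain ⟨e, M, hM⟩ := exists_hasStructureMatrix hA
    have hS' := (isSimpleTwoDim_congr hM.algIsomorphic).1 hS
    have h22 : (2 : F) * (1 / 2) = 1 := by field_simp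
    obtain ⟨N, hN, hiso⟩ := exists_isReducedForm (Q := fun α _ => α = 0) (M₀ := A11) hF
      -- The shift by `α / 2` removes the first structure constant.
      (fun α β l r => ⟨α * (1 / 2), by linear_combination -α * h22⟩) (by
        rintro α β rfl hs
        rw [A11_eq_aligned]
        have hβ : β ≠ 0 := by
          rintro rfl
          exact not_isSimpleTwoDim_A10 hs
        obtain ⟨a, ha⟩ := hF.exists_sq_eq β
        have ha0 : a ≠ 0 := by
          rintro rfl
          exact hβ (by rw [← ha]; ring)
        exact (isIsoMatrix_aligned (a := a) (c := 0) (d := 1) ha0 one_ne_zero (by ring) (by ring)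
          (by ring) (by linear_combination -ha) (by ring) (by ring)).algIsomorphic) hS'
    exact ⟨N, mem_simpleForms hF h2 hN ((isSimpleTwoDim_congr hiso).1 hS'),
      hM.algIsomorphic.trans hiso⟩
  · rintro ⟨M, hM, hiso⟩
    exact (isSimpleTwoDim_congr hiso).2 (isSimpleTwoDim_of_mem_simpleForms h2 hM)

theorem algIsomorphic_simpleForms_iff (h2 : (2 : F) ≠ 0) (hM : M ∈ simpleForms F)
    (hN : N ∈ simpleForms F) :
    AlgIsomorphic F (MSCAlg M) (MSCAlg N) ↔ M = N ∨ SignRelated M N := by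
  constructor
  · refine (isReducedForm_of_mem_simpleForms hM).eq_or_signRelated A11_eq_aligned ?_
      (isReducedForm_of_mem_simpleForms hN)
    rintro _ β _ β' l r c rfl rfl hα hβ
    have hc : c = 0 := by
      apply mul_left_cancel₀ h2
      linear_combination -hα
    subst hc
    exact ⟨rfl, by linear_combination hβ⟩
  · rintro (rfl | h)
    · exact AlgIsomorphic.refl _
    · exact algIsomorphic_of_signRelated h

theorem A3c2_eq_aligned (h2 : (2 : F) = 0) (α₁ β₂ : F) :
    A3c2 α₁ β₂ = aligned α₁ 1 0 0 (β₂ + α₁) 1 := by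
  have : (1 : F) = -1 := by linear_combination h2
  simp [A3c2, aligned, ← this]

theorem A6c2_eq_aligned (h2 : (2 : F) = 0) (α₁ β₁ : F) : A6c2 α₁ β₁ = aligned α₁ 0 1 β₁ 1 0 := by
  have : α₁ = -α₁ := by linear_combination α₁ * h2
  simp [A6c2, aligned, ← this]

theorem A7c2_eq_aligned (h2 : (2 : F) = 0) (α₁ : F) : A7c2 α₁ = aligned α₁ 1 0 0 1 0 := by
  have h : α₁ = -α₁ := by linear_combination α₁ * h2
  have : (1 : F) = -1 := by linear_combination h2
  simp [A7c2, aligned, ← this, ← h]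

theorem A11c2_eq_aligned (h2 : (2 : F) = 0) :
    (A11c2 : Matrix (Fin 2) (Fin 4) F) = aligned 1 1 0 0 0 0 := by
  have : (1 : F) = -1 := by linear_combination h2
  simp [A11c2, aligned, ← this]

theorem isReducedForm_of_mem_simpleFormsc2 (h2 : (2 : F) = 0) (h : M ∈ simpleFormsc2 F) :
    IsReducedForm (fun _ β => β = 0) A11c2 M := by
  rcases h with ⟨a, b, c, d, -, rfl⟩ | ⟨a, b, c, -, rfl⟩ | ⟨b, c, -, rfl⟩ | ⟨a, b, rfl⟩ | ⟨b, rfl⟩ |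
    rfl
  · exact Or.inl ⟨a, b, c, d, rfl⟩
  · exact Or.inr (Or.inl ⟨_, _, _, _, _, _, A2_eq_aligned a b c, Or.inl rfl, Or.inl ⟨rfl, rfl⟩⟩)
  · exact Or.inr (Or.inl ⟨_, _, _, _, _, _, A3c2_eq_aligned h2 b c, Or.inl rfl,
      Or.inr ⟨rfl, rfl, rfl⟩⟩)
  · exact Or.inr (Or.inl ⟨_, _, _, _, _, _, A6c2_eq_aligned h2 a b, Or.inr ⟨rfl, rfl⟩,
      Or.inl ⟨rfl, rfl⟩⟩)
  · exact Or.inr (Or.inl ⟨_, _, _, _, _, _, A7c2_eq_aligned h2 b, Or.inr ⟨rfl, rfl⟩,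
      Or.inr ⟨rfl, rfl, rfl⟩⟩)
  · exact Or.inr (Or.inr rfl)

theorem numIdeals_A1_of_two_eq_zero (h2 : (2 : F) = 0) (α₁ α₂ α₄ β₁ : F) :
    (numIdeals (A1 α₁ α₂ α₄ β₁) = 0 ↔ α₄ ≠ α₁ ∨ β₁ ≠ α₂) ∧
      (numIdeals (A1 α₁ α₂ α₄ β₁) = 1 ↔ α₄ = α₁ ∧ β₁ = α₂) := by
  have h := numIdeals_A1 α₁ α₂ α₄ β₁
  rwa [show -α₁ - 2 * α₂ = α₁ by linear_combination (-α₁ - α₂) * h2,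
    show 2 * α₁ + α₂ = α₂ by linear_combination α₁ * h2] at h

theorem isSimpleTwoDim_of_mem_simpleFormsc2 (h2 : (2 : F) = 0) (h : M ∈ simpleFormsc2 F) :
    IsSimpleTwoDim F (MSCAlg M) := by
  rw [isSimpleTwoDim_iff_numIdeals]
  rcases h with ⟨a, b, c, d, h, rfl⟩ | ⟨a, b, c, h, rfl⟩ | ⟨b, c, h, rfl⟩ | ⟨a, b, rfl⟩ | ⟨b, rfl⟩ |
    rfl
  · exact (numIdeals_A1_of_two_eq_zero h2 a b c d).1.2 h
  · exact (numIdeals_A2_of_two_eq_zero h2 a b c).1.2 h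
  · exact (numIdeals_A3c2 h2 b c).1.2 h
  · exact numIdeals_A6c2 h2 a b
  · exact numIdeals_A7c2 h2 b
  · exact numIdeals_A11c2

theorem mem_simpleFormsc2 (h2 : (2 : F) = 0)
    (h : IsReducedForm (fun _ β => β = 0) A11c2 M) (hM : IsSimpleTwoDim F (MSCAlg M)) :
    M ∈ simpleFormsc2 F := by
  rw [isSimpleTwoDim_iff_numIdeals] at hM
  rcases h with ⟨a, b, c, d, rfl⟩ |
    ⟨α, s, ε, β, l, r, rfl, rfl | ⟨rfl, rfl⟩, ⟨rfl, rfl⟩ | ⟨rfl, rfl, rfl⟩⟩ | rfl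
  · exact Or.inl ⟨a, b, c, d, (numIdeals_A1_of_two_eq_zero h2 a b c d).1.1 hM, rfl⟩
  · rw [show aligned α 0 1 β l 1 = A2 α β (l - α) by simp [aligned, A2]] at hM ⊢
    exact Or.inr (Or.inl ⟨_, _, _, (numIdeals_A2_of_two_eq_zero h2 _ _ _).1.1 hM, rfl⟩)
  · obtain ⟨b, rfl⟩ : ∃ b, l = b + α := ⟨l - α, by ring⟩
    rw [← A3c2_eq_aligned h2] at hM ⊢
    exact Or.inr (Or.inr (Or.inl ⟨_, _, (numIdeals_A3c2 h2 _ _).1.1 hM, rfl⟩))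
  · exact Or.inr (Or.inr (Or.inr (Or.inl ⟨_, _, (A6c2_eq_aligned h2 _ _).symm⟩)))
  · exact Or.inr (Or.inr (Or.inr (Or.inr (Or.inl ⟨_, (A7c2_eq_aligned h2 _).symm⟩))))
  · exact Or.inr (Or.inr (Or.inr (Or.inr (Or.inr rfl))))

theorem isSimpleTwoDim_iff_simpleFormsc2 (hF : QuadraticCubicClosed F) (h2 : (2 : F) = 0)
    {A : Type*} [NonUnitalNonAssocRing A] [Module F A] [IsScalarTower F A A]
    [SMulCommClass F A A] (hA : Module.finrank F A = 2) :
    IsSimpleTwoDim F A ↔ ∃ M ∈ simpleFormsc2 F, AlgIsomorphic F A (MSCAlg M) := by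
  constructor
  · intro hS
    obtain ⟨e, M, hM⟩ := exists_hasStructureMatrix hA
    have hS' := (isSimpleTwoDim_congr hM.algIsomorphic).1 hS
    obtain ⟨N, hN, hiso⟩ := exists_isReducedForm (Q := fun _ β => β = 0) (M₀ := A11c2) hF
      -- The shift cannot change `α` here; instead it removes `β`, at the cost of a quadratic equation.
      (fun α β l r => by
        obtain ⟨c, hc⟩ := hF.exists_quadratic_root (3 * α - l - r) β one_ne_zero
        exact ⟨c, by linear_combination hc - 2 * c ^ 2 * h2⟩) (by
        rintro α β rfl hs
        rw [A11c2_eq_aligned h2]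
        have hα : α ≠ 0 := by
          rintro rfl
          exact not_isSimpleTwoDim_A10 hs
        exact (isIsoMatrix_aligned (a := α) (c := 0) (d := 1) hα one_ne_zero (by ring) (by ring)
          (by ring) (by ring) (by ring) (by ring)).algIsomorphic) hS'
    exact ⟨N, mem_simpleFormsc2 h2 hN ((isSimpleTwoDim_congr hiso).1 hS'),
      hM.algIsomorphic.trans hiso⟩
  · rintro ⟨M, hM, hiso⟩
    exact (isSimpleTwoDim_congr hiso).2 (isSimpleTwoDim_of_mem_simpleFormsc2 h2 hM)

theorem algIsomorphic_simpleFormsc2_iff (h2 : (2 : F) = 0) (hM : M ∈ simpleFormsc2 F)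
    (hN : N ∈ simpleFormsc2 F) :
    AlgIsomorphic F (MSCAlg M) (MSCAlg N) ↔ M = N := by
  constructor
  · intro h
    have hneg : ∀ x : F, -x = x := fun x => by linear_combination -x * h2
    rcases (isReducedForm_of_mem_simpleFormsc2 h2 hM).eq_or_signRelated (A11c2_eq_aligned h2)
      (by
        rintro α _ α' _ l r c rfl rfl hα -
        exact ⟨by linear_combination hα + c * h2, rfl⟩)
      (isReducedForm_of_mem_simpleFormsc2 h2 hN) h with h | h
    · exact h
    · rcases h with ⟨_, _, _, rfl, rfl⟩ | ⟨_, _, rfl, rfl⟩ <;> rw [hneg]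
  · rintro rfl
    exact AlgIsomorphic.refl _

theorem simpleFormsc3_eq (h3 : (3 : F) = 0) : simpleFormsc3 F = simpleForms F := by
  have h4 : (4 : F) = 1 := by linear_combination h3
  simp only [simpleFormsc3, simpleForms, h4, div_one]
  rfl

end Lists

/-! ### Counts and classification in each characteristic -/

theorem proposition7p1 {F : Type*} [Field F] (hF : QuadraticCubicClosed F) :
    -- the criterion, for an arbitrary two-dimensional algebra in an arbitrary basis
    (∀ (A : Type*) [NonUnitalNonAssocRing A] [Module F A] [IsScalarTower F A A]
        [SMulCommClass F A A] (e : Module.Basis (Fin 2) F A) (α₁ α₂ α₃ α₄ β₁ β₂ β₃ β₄ : F),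
      e 0 * e 0 = α₁ • e 0 + β₁ • e 1 → e 0 * e 1 = α₂ • e 0 + β₂ • e 1 →
      e 1 * e 0 = α₃ • e 0 + β₃ • e 1 → e 1 * e 1 = α₄ • e 0 + β₄ • e 1 →
      (IsSimpleTwoDim F A ↔
        (β₂ ≠ β₃ ∧ α₂ = α₃ ∧ α₃ ≠ 0) ∨
        (β₂ ≠ β₃ ∧ α₂ = α₃ ∧ α₃ = 0 ∧ α₄ ≠ 0) ∨
        (α₂ ≠ α₃ ∧
          ((β₃ - β₂) ^ 2 * α₂ + (β₃ - β₂) * (α₃ - α₂) * (α₁ - β₂) - (α₃ - α₂) ^ 2 * β₁ ≠ 0 ∨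
           (β₃ - β₂) ^ 2 * α₄ + (β₃ - β₂) * (α₃ - α₂) * (α₃ - β₄) - (α₃ - α₂) ^ 2 * β₃ ≠ 0)) ∨
        (β₂ = β₃ ∧ α₂ = α₃ ∧ nontrivialLeftIdeals F A = ∅)) ∧
      (α₂ = 0 ∧ α₃ = 0 ∧ α₄ = 0 →
        Submodule.span F {e 1} ∈ nontrivialTwoSidedIdeals F A) ∧
      (α₂ ≠ α₃ →
        (Submodule.span F {e 0 + ((β₃ - β₂) / (α₃ - α₂)) • e 1} ∈ nontrivialTwoSidedIdeals F A ↔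
          (β₃ - β₂) ^ 2 * α₂ + (β₃ - β₂) * (α₃ - α₂) * (α₁ - β₂) - (α₃ - α₂) ^ 2 * β₁ = 0 ∧
          (β₃ - β₂) ^ 2 * α₄ + (β₃ - β₂) * (α₃ - α₂) * (α₃ - β₄) - (α₃ - α₂) ^ 2 * β₃ = 0)) ∧
      (β₃ = β₂ → α₃ = α₂ →
        (∀ x y : A, x * y = y * x) ∧
        nontrivialLeftIdeals F A = nontrivialTwoSidedIdeals F A ∧
        nontrivialRightIdeals F A = nontrivialTwoSidedIdeals F A)) ∧
    -- a nontrivial two-dimensional algebra has `0`, `1` or `2` nontrivial two-sided ideals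
    (∀ (A : Type*) [NonUnitalNonAssocRing A] [Module F A] [IsScalarTower F A A]
        [SMulCommClass F A A], Module.finrank F A = 2 → (∃ x y : A, x * y ≠ 0) →
      (nontrivialTwoSidedIdeals F A).encard = 0 ∨ (nontrivialTwoSidedIdeals F A).encard = 1 ∨
      (nontrivialTwoSidedIdeals F A).encard = 2) ∧
    -- the numbers of nontrivial two-sided ideals, and the simple algebras, by characteristic
    (ringChar F ≠ 2 → ringChar F ≠ 3 →
      (∀ α₁ α₂ α₄ β₁ : F,
        (numIdeals (A1 α₁ α₂ α₄ β₁) = 0 ↔ α₄ ≠ -α₁ - 2 * α₂ ∨ β₁ ≠ 2 * α₁ + α₂) ∧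
        (numIdeals (A1 α₁ α₂ α₄ β₁) = 1 ↔ α₄ = -α₁ - 2 * α₂ ∧ β₁ = 2 * α₁ + α₂)) ∧
      (∀ α₁ β₁ β₂ : F,
        (numIdeals (A2 α₁ β₁ β₂) = 0 ↔
          β₂ ≠ 1 - α₁ ∨ β₁ ^ 2 + (α₁ - 1) * (2 * α₁ - 1) ^ 2 ≠ 0) ∧
        (numIdeals (A2 α₁ β₁ β₂) = 1 ↔
          α₁ ≠ 1 / 2 ∧ β₂ = 1 - α₁ ∧ β₁ ^ 2 + (α₁ - 1) * (2 * α₁ - 1) ^ 2 = 0) ∧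
        (numIdeals (A2 α₁ β₁ β₂) = 2 ↔ α₁ = 1 / 2 ∧ β₂ = 1 / 2 ∧ β₁ = 0)) ∧
      (∀ β₁ β₂ : F,
        (numIdeals (A3 β₁ β₂) = 0 ↔ β₂ ≠ 1 ∨ β₁ ≠ -(1 / 4)) ∧
        (numIdeals (A3 β₁ β₂) = 1 ↔ β₂ = 1 ∧ β₁ = -(1 / 4))) ∧
      (∀ α₁ β₂ : F,
        (numIdeals (A4 α₁ β₂) = 1 ↔ α₁ ≠ 1 ∨ β₂ ≠ 0) ∧
        (numIdeals (A4 α₁ β₂) = 2 ↔ α₁ = 1 ∧ β₂ = 0)) ∧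
      (∀ α₁ : F, numIdeals (A5 α₁) = 1) ∧
      (∀ α₁ β₁ : F, numIdeals (A6 α₁ β₁) = 0) ∧
      (∀ β₁ : F, numIdeals (A7 β₁) = 0) ∧
      (∀ α₁ : F, numIdeals (A8 α₁) = 1) ∧
      numIdeals (A9 : Matrix (Fin 2) (Fin 4) F) = 1 ∧
      numIdeals (A10 : Matrix (Fin 2) (Fin 4) F) = 1 ∧
      numIdeals (A11 : Matrix (Fin 2) (Fin 4) F) = 0 ∧
      numIdeals (A12 : Matrix (Fin 2) (Fin 4) F) = 1 ∧
      (∀ (A : Type*) [NonUnitalNonAssocRing A] [Module F A] [IsScalarTower F A A]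
          [SMulCommClass F A A], Module.finrank F A = 2 →
        (IsSimpleTwoDim F A ↔ ∃ M ∈ simpleForms F, AlgIsomorphic F A (MSCAlg M))) ∧
      (∀ M ∈ simpleForms F, ∀ N ∈ simpleForms F,
        (AlgIsomorphic F (MSCAlg M) (MSCAlg N) ↔ M = N ∨ SignRelated M N))) ∧
    (ringChar F = 2 →
      (∀ α₁ α₂ α₄ β₁ : F,
        (numIdeals (A1 α₁ α₂ α₄ β₁) = 0 ↔ α₄ ≠ α₁ ∨ β₁ ≠ α₂) ∧
        (numIdeals (A1 α₁ α₂ α₄ β₁) = 1 ↔ α₄ = α₁ ∧ β₁ = α₂)) ∧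
      (∀ α₁ β₁ β₂ : F,
        (numIdeals (A2 α₁ β₁ β₂) = 0 ↔ β₂ ≠ 1 - α₁ ∨ 1 - α₁ + β₁ ^ 2 ≠ 0) ∧
        (numIdeals (A2 α₁ β₁ β₂) = 1 ↔ β₂ = 1 - α₁ ∧ 1 - α₁ + β₁ ^ 2 = 0)) ∧
      (∀ α₁ β₂ : F,
        (numIdeals (A3c2 α₁ β₂) = 0 ↔ α₁ ≠ 1 ∨ β₂ ≠ 0) ∧
        (numIdeals (A3c2 α₁ β₂) = 2 ↔ α₁ = 1 ∧ β₂ = 0)) ∧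
      (∀ α₁ β₂ : F,
        (numIdeals (A4 α₁ β₂) = 1 ↔ α₁ ≠ 1 ∨ β₂ ≠ 0) ∧
        (numIdeals (A4 α₁ β₂) = 2 ↔ α₁ = 1 ∧ β₂ = 0)) ∧
      (∀ α₁ : F, numIdeals (A5c2 α₁) = 1) ∧
      (∀ α₁ β₁ : F, numIdeals (A6c2 α₁ β₁) = 0) ∧
      (∀ α₁ : F, numIdeals (A7c2 α₁) = 0) ∧
      (∀ α₁ : F, numIdeals (A8c2 α₁) = 1) ∧
      numIdeals (A9c2 : Matrix (Fin 2) (Fin 4) F) = 1 ∧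
      numIdeals (A10c2 : Matrix (Fin 2) (Fin 4) F) = 1 ∧
      numIdeals (A11c2 : Matrix (Fin 2) (Fin 4) F) = 0 ∧
      numIdeals (A12 : Matrix (Fin 2) (Fin 4) F) = 1 ∧
      (∀ (A : Type*) [NonUnitalNonAssocRing A] [Module F A] [IsScalarTower F A A]
          [SMulCommClass F A A], Module.finrank F A = 2 →
        (IsSimpleTwoDim F A ↔ ∃ M ∈ simpleFormsc2 F, AlgIsomorphic F A (MSCAlg M))) ∧
      (∀ M ∈ simpleFormsc2 F, ∀ N ∈ simpleFormsc2 F,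
        (AlgIsomorphic F (MSCAlg M) (MSCAlg N) ↔ M = N))) ∧
    (ringChar F = 3 →
      (∀ α₁ α₂ α₄ β₁ : F,
        (numIdeals (A1 α₁ α₂ α₄ β₁) = 0 ↔ α₄ ≠ -α₁ - 2 * α₂ ∨ β₁ ≠ 2 * α₁ + α₂) ∧
        (numIdeals (A1 α₁ α₂ α₄ β₁) = 1 ↔ α₄ = -α₁ - 2 * α₂ ∧ β₁ = 2 * α₁ + α₂)) ∧
      (∀ α₁ β₁ β₂ : F,
        (numIdeals (A2 α₁ β₁ β₂) = 0 ↔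
          β₂ ≠ 1 - α₁ ∨ β₁ ^ 2 + (α₁ - 1) * (2 * α₁ - 1) ^ 2 ≠ 0) ∧
        (numIdeals (A2 α₁ β₁ β₂) = 1 ↔
          α₁ ≠ 1 / 2 ∧ β₂ = 1 - α₁ ∧ β₁ ^ 2 + (α₁ - 1) * (2 * α₁ - 1) ^ 2 = 0) ∧
        (numIdeals (A2 α₁ β₁ β₂) = 2 ↔ α₁ = 1 / 2 ∧ β₂ = 1 / 2 ∧ β₁ = 0)) ∧
      (∀ β₁ β₂ : F,
        (numIdeals (A3 β₁ β₂) = 0 ↔ β₂ ≠ 1 ∨ β₁ ≠ -1) ∧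
        (numIdeals (A3 β₁ β₂) = 1 ↔ β₂ = 1 ∧ β₁ = -1)) ∧
      (∀ α₁ β₂ : F,
        (numIdeals (A4 α₁ β₂) = 1 ↔ α₁ ≠ 1 ∨ β₂ ≠ 0) ∧
        (numIdeals (A4 α₁ β₂) = 2 ↔ α₁ = 1 ∧ β₂ = 0)) ∧
      (∀ α₁ : F, numIdeals (A5c3 α₁) = 1) ∧
      (∀ α₁ β₁ : F, numIdeals (A6 α₁ β₁) = 0) ∧
      (∀ β₁ : F, numIdeals (A7 β₁) = 0) ∧
      (∀ α₁ : F, numIdeals (A8 α₁) = 1) ∧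
      numIdeals (A9c3 : Matrix (Fin 2) (Fin 4) F) = 0 ∧
      numIdeals (A10 : Matrix (Fin 2) (Fin 4) F) = 1 ∧
      numIdeals (A11c3 : Matrix (Fin 2) (Fin 4) F) = 1 ∧
      numIdeals (A12 : Matrix (Fin 2) (Fin 4) F) = 1 ∧
      (∀ (A : Type*) [NonUnitalNonAssocRing A] [Module F A] [IsScalarTower F A A]
          [SMulCommClass F A A], Module.finrank F A = 2 →
        (IsSimpleTwoDim F A ↔ ∃ M ∈ simpleFormsc3 F, AlgIsomorphic F A (MSCAlg M))) ∧
      (∀ M ∈ simpleFormsc3 F, ∀ N ∈ simpleFormsc3 F,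
        (AlgIsomorphic F (MSCAlg M) (MSCAlg N) ↔ M = N ∨ SignRelated M N))) := by
  refine ⟨?_, ?_, ?_, ?_, ?_⟩
  · intro A _ _ _ _ e α₁ α₂ α₃ α₄ β₁ β₂ β₃ β₄ h00 h01 h10 h11
    have hM : HasStructureMatrix e !![α₁, α₂, α₃, α₄; β₁, β₂, β₃, β₄] :=
      ⟨by simpa using h00, by simpa using h01, by simpa using h10, by simpa using h11⟩
    refine ⟨isSimpleTwoDim_criterion hM, ?_, ?_, ?_⟩
    · rintro ⟨rfl, rfl, rfl⟩
      have h := (span_mem_ideals_iff hM (x := 0) (y := 1) (Or.inr one_ne_zero)).2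
        (by constructor <;> simp)
      simpa using h
    · intro h
      rw [← one_smul F (e 0), span_mem_ideals_iff hM (Or.inl one_ne_zero)]
      exact isIdealDirection_commutator_iff
        (M := !![α₁, α₂, α₃, α₄; β₁, β₂, β₃, β₄]) h
    · intro hβ hα
      have hc := mul_comm_of_structureMatrix hM hα.symm hβ.symm
      exact ⟨hc, ideals_eq_of_comm hc⟩
  · intro A _ _ _ _ hA hne
    obtain ⟨e, M, hM⟩ := exists_hasStructureMatrix hA
    exact ENat.eq_zero_or_one_or_two (encard_ideals_le_two hM hne)
  · intro hc2 hc3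
    have h2 : (2 : F) ≠ 0 := Ring.two_ne_zero hc2
    have h3 : (3 : F) ≠ 0 := fun h => by
      have hdvd : ringChar F ∣ 3 := (ringChar.spec F 3).1 (by exact_mod_cast h)
      rcases (Nat.dvd_prime Nat.prime_three).1 hdvd with h | h
      · exact CharP.ringChar_ne_one h
      · exact hc3 h
    exact ⟨numIdeals_A1, numIdeals_A2 h2 hF.exists_sq_eq, numIdeals_A3 h2, numIdeals_A4,
      numIdeals_A5, numIdeals_A6, numIdeals_A7, numIdeals_A8, numIdeals_A9 h3, numIdeals_A10,
      numIdeals_A11 h2, numIdeals_A12,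
      fun A _ _ _ _ hA => isSimpleTwoDim_iff_simpleForms hF h2 hA,
      fun M hM N hN => algIsomorphic_simpleForms_iff h2 hM hN⟩
  · intro hc
    have h2 : (2 : F) = 0 := by exact_mod_cast (ringChar.spec F 2).2 hc.dvd
    exact ⟨numIdeals_A1_of_two_eq_zero h2, numIdeals_A2_of_two_eq_zero h2, numIdeals_A3c2 h2,
      numIdeals_A4, numIdeals_A5c2, numIdeals_A6c2 h2, numIdeals_A7c2 h2, numIdeals_A8c2,
      numIdeals_A9c2, numIdeals_A10c2, numIdeals_A11c2, numIdeals_A12,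
      fun A _ _ _ _ hA => isSimpleTwoDim_iff_simpleFormsc2 hF h2 hA,
      fun M hM N hN => algIsomorphic_simpleFormsc2_iff h2 hM hN⟩
  · intro hc
    have h3 : (3 : F) = 0 := by exact_mod_cast (ringChar.spec F 3).2 hc.dvd
    have h2 : (2 : F) ≠ 0 := fun h2 => one_ne_zero (α := F) (by linear_combination h3 - h2)
    have h4 : (4 : F) = 1 := by linear_combination h3
    rw [simpleFormsc3_eq h3]
    exact ⟨numIdeals_A1, numIdeals_A2 h2 hF.exists_sq_eq,
      fun β₁ β₂ => by simpa [h4] using numIdeals_A3 h2 β₁ β₂, numIdeals_A4,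
      numIdeals_A5c3 h3, numIdeals_A6, numIdeals_A7, numIdeals_A8, numIdeals_A9c3 h2,
      numIdeals_A10, numIdeals_A11c3, numIdeals_A12,
      fun A _ _ _ _ hA => isSimpleTwoDim_iff_simpleForms hF h2 hA,
      fun M hM N hN => algIsomorphic_simpleForms_iff h2 hM hN⟩
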